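/- **Spatially averaged coverage probability in the LOS-ball model.** *Setting.* Let $0<r_{\rm in}<r_{\rm out}$ and $r_{\rm in}\le R_B\le r_{\rm out}$. Let $\mathcal A=\{x\in\mathbb C: r_{\rm in}\le|x|\le r_{\rm out}\}$, with area $|\mathcal A|$; the reference receiver is at the origin. There are $K\ge 0$ potential interferers at independent locations $X_1,\dots,X_K$, each uniform on $\mathcal A$ (a binomial point process); write $R_i=|X_i|$ and $\phi_i=\arg X_i$. An interferer is LOS, with Nakagami factor $m_i=m_L>0$ and path-loss exponent $\alpha_i=\alpha_L>0$, if $R_i\le R_B$; it is NLOS, with $m_i=m_N>0$ and $\alpha_i=\alpha_N>0$, if $R_i>R_B$. Let $P_0,P_i>0$ be the transmit powers, $G_t,g_t,G_r,g_r>0$ the main- and side-lobe gains of the transmitters and of the receiver, and $\theta_t^{(a)},\theta_t^{(e)},\theta_r^{(a)}\in[0,2\pi]$ the beamwidths. Put $a_i=\frac{P_i}{P_0}G_r$ and $b_i=\frac{P_i}{P_0}g_r$. The normalized power gain is $\Omega_i=a_iR_i^{-\alpha_i}$ if $|\phi_i-\phi_0|\le\theta_r^{(a)}/2$ (the angle difference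 being reduced to $(-\pi,\pi]$), and $\Omega_i=b_iR_i^{-\alpha_i}$ otherwise. The relative radiated power $I_i$ takes the values $0,G_t,g_t$ with probabilities $1-p_t,\ p_tp_M,\ p_t(1-p_M)$, where $p_t\in[0,1]$ and $p_M=\frac{\theta_t^{(a)}}{2\pi}\sin\frac{\theta_t^{(e)}}2$. Given $X_i$, the fading gain $h_i$ is gamma distributed with shape $m_i$ and mean $1$. $I_i$ is independent of $(X_i,h_i)$, and the triples $(X_i,I_i,h_i)$, $1\le i\le K$, are independent. The reference fading gain $h_0$ is gamma distributed with shape $m_0$ and mean $1$, where $m_0\ge1$ is an integer, and is independent of all the triples. With $\Omega_0=G_rR_0^{-\alpha_0}$ (where $R_0>0$, $\alpha_0\in\mathbb R$) and $\sigma^2>0$, the SINR is $$\gamma=\frac{G_th_0\Omega_0}{\sigma^2+\sum_{i=1}^K I_ih_i\Omega_i}.$$ For $\beta>0$ put $\beta_0=\beta m_0/(G_t\Omega_0)$. For an integer $t\ge 0$ and $m,w>0$ put $$\mathcal G_t(w;m)=p_t\Big(\frac wm\Big)^t\frac{\Gamma(m+t)}{t!\,\Gamma(m)}\big[p_M\mathcal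 Q_t(G_t)+(1-p_M)\mathcal Q_t(g_t)\big]+(1-p_t)\delta[t],\qquad \mathcal Q_t(x)=x^t\Big(1+\frac{\beta_0xw}{m}\Big)^{-(m+t)},$$ with $\delta[0]=1$ and $\delta[t]=0$ for $t\ne0$; write $\mathcal G_t(\Omega_i)=\mathcal G_t(\Omega_i;m_i)$. *Claim.* For every $\beta>0$, with $\mathcal S_t$ the set of all $(t_1,\dots,t_K)\in\mathbb Z_{\ge0}^K$ with sum $t$, $$\mathbb P[\gamma>\beta]=\mathbb E\big[\mathbb P[\gamma>\beta\mid X_1,\dots,X_K]\big]=e^{-\beta_0\sigma^2}\sum_{\ell=0}^{m_0-1}\frac{(\beta_0\sigma^2)^\ell}{\ell!}\sum_{t=0}^{\ell}\binom{\ell}{t}\frac{t!}{\sigma^{2t}}\sum_{(t_1,\dots,t_K)\in\mathcal S_t}\ \prod_{i=1}^K\mathbb E[\mathcal G_{t_i}(\Omega_i)].$$ Each expectation is finite and given in closed form by $$\mathbb E[\mathcal G_t(\Omega_i)]=\frac{\theta_r^{(a)}}{2\pi}\,\mathcal E_t(a_i)+\Big(1-\frac{\theta_r^{(a)}}{2\pi}\Big)\mathcal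 E_t(b_i),$$ $$\mathcal E_t(c)=\mathcal T_t\Big(m_L;\frac c{R_B^{\alpha_L}},\frac c{r_{\rm in}^{\alpha_L}};c;\alpha_L\Big)+\mathcal T_t\Big(m_N;\frac c{r_{\rm out}^{\alpha_N}},\frac c{R_B^{\alpha_N}};c;\alpha_N\Big),$$ where $$\mathcal T_t(m;\omega_1,\omega_2;c;\alpha)=(1-p_t)\frac{\pi c^{2/\alpha}}{|\mathcal A|}\Big[\frac1{\omega_1^{2/\alpha}}-\frac1{\omega_2^{2/\alpha}}\Big]\delta[t]+p_t\,\mathcal K_t(\alpha,c)\Big\{p_M\Delta(G_t)+(1-p_M)\Delta(g_t)\Big\},$$ $$\Delta(g)=\frac{\mathcal M_t(g\omega_1;\alpha)}{\omega_1^{2/\alpha}}-\frac{\mathcal M_t(g\omega_2;\alpha)}{\omega_2^{2/\alpha}},\qquad \mathcal K_t(\alpha,c)=\frac{2\pi m^m\,\Gamma(m+t)\,\beta_0^{-(m+t)}c^{2/\alpha}}{\Gamma(m)\,|\mathcal A|\,t!\,\alpha},$$ $$\mathcal M_t(x;\alpha)=\frac{{}_2F_1\big(m+t,\,m+\frac2\alpha;\,m+\frac2\alpha+1;\,-\frac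 m{x\beta_0}\big)}{x^m\,(m+\frac2\alpha)},$$ and ${}_2F_1$ is the Gauss hypergeometric function (the analytic continuation of the Gauss series to $(-\infty,1)$). Moreover, for all $m,\alpha,c>0$, $0<\omega_1\le\omega_2$ and integers $t\ge0$, the function below is integrable and $$\int_0^\infty\mathcal D(\omega;[\omega_1,\omega_2];c;\alpha)\,\mathcal G_t(\omega;m)\,d\omega=\mathcal T_t(m;\omega_1,\omega_2;c;\alpha),\qquad \mathcal D(\omega;[\omega_1,\omega_2];c;\alpha)=\frac{2\pi\,\omega^{-(2+\alpha)/\alpha}}{\alpha|\mathcal A|}c^{2/\alpha}\,\mathbf 1_{[\omega_1,\omega_2]}(\omega).$$ -/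

import Mathlib

open MeasureTheory ProbabilityTheory Set

namespace MmWave

/-! ### The Gauss hypergeometric function on `(-∞, 1)` -/

/-- `F` continues the Gauss series `∑ (a)_n (b)_n / (c)_n z^n / n!` from `(-1, 1)` to `(-∞, 1)`
real-analytically. -/
def IsGaussContinuation (a b c : ℝ) (F : ℝ → ℝ) : Prop :=
  AnalyticOnNhd ℝ F (Iio 1) ∧ ∀ z : ℝ, |z| < 1 → F z = ordinaryHypergeometric a b c z

/-- The continuation is unique, so that the next definition is unambiguous. -/
theorem IsGaussContinuation.eqOn {a b c : ℝ} {F G : ℝ → ℝ}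
    (hF : IsGaussContinuation a b c F) (hG : IsGaussContinuation a b c G) :
    EqOn F G (Iio 1) := by
  refine hF.1.eqOn_of_preconnected_of_eventuallyEq hG.1 isPreconnected_Iio
    (z₀ := 0) (by simp) ?_
  filter_upwards [Ioo_mem_nhds (show (-1 : ℝ) < 0 by norm_num) (show (0 : ℝ) < 1 by norm_num)]
    with z hz
  have hz' : |z| < 1 := abs_lt.mpr hz
  rw [hF.2 z hz', hG.2 z hz']

/-- The Gauss hypergeometric function `₂F₁(a, b; c; z)` for real parameters and real `z < 1`:
the analytic continuation of the Gauss series. (The bare series diverges for `z < -1`.) -/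
noncomputable def gauss2F1 (a b c z : ℝ) : ℝ :=
  Classical.epsilon (IsGaussContinuation a b c) z

/-! ### The network -/

/-- The deterministic parameters of a finite network with `K` potential interferers. -/
structure Network (K : ℕ) where
  /-- inner radius of the annulus -/
  rIn : ℝ
  /-- outer radius of the annulus -/
  rOut : ℝ
  /-- radius of the line-of-sight ball -/
  rB : ℝ
  /-- Nakagami factor of a line-of-sight interferer -/
  mL : ℝ
  /-- Nakagami factor of a non-line-of-sight interferer -/
  mN : ℝ
  /-- path-loss exponent of a line-of-sight interferer -/
  αL : ℝ
  /-- path-loss exponent of a non-line-of-sight interferer -/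
  αN : ℝ
  /-- Nakagami factor of the reference link, a positive integer -/
  m₀ : ℕ
  /-- path-loss exponent of the reference link -/
  α₀ : ℝ
  /-- length of the reference link -/
  R₀ : ℝ
  /-- azimuth angle of the reference transmitter -/
  φ₀ : ℝ
  /-- transmit power of the reference transmitter -/
  P₀ : ℝ
  /-- transmit powers of the interferers -/
  P : Fin K → ℝ
  /-- normalized noise power `σ²` -/
  noise : ℝ
  /-- main-lobe gain of the transmitters -/
  Gt : ℝ
  /-- side-lobe gain of the transmitters -/
  gt : ℝ
  /-- main-lobe gain of the receiver -/
  Gr : ℝ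
  /-- side-lobe gain of the receiver -/
  gr : ℝ
  /-- azimuth half-power beamwidth of the transmitters -/
  θta : ℝ
  /-- elevation half-power beamwidth of the transmitters -/
  θte : ℝ
  /-- azimuth half-power beamwidth of the receiver -/
  θra : ℝ
  /-- probability that an interferer transmits -/
  pt : ℝ
  rIn_pos : 0 < rIn
  rIn_lt_rOut : rIn < rOut
  rIn_le_rB : rIn ≤ rB
  rB_le_rOut : rB ≤ rOut
  mL_pos : 0 < mL
  mN_pos : 0 < mN
  αL_pos : 0 < αL
  αN_pos : 0 < αN
  m₀_pos : 0 < m₀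
  R₀_pos : 0 < R₀
  P₀_pos : 0 < P₀
  P_pos : ∀ i, 0 < P i
  noise_pos : 0 < noise
  Gt_pos : 0 < Gt
  gt_pos : 0 < gt
  Gr_pos : 0 < Gr
  gr_pos : 0 < gr
  θta_mem : θta ∈ Icc 0 (2 * Real.pi)
  θte_mem : θte ∈ Icc 0 (2 * Real.pi)
  θra_mem : θra ∈ Icc 0 (2 * Real.pi)
  pt_mem : pt ∈ Icc 0 1

namespace Network

noncomputable section

variable {K : ℕ} (N : Network K)

/-- The network region `𝒜`, an annulus around the reference receiver at the origin. -/
def region : Set ℂ := {x | N.rIn ≤ ‖x‖ ∧ ‖x‖ ≤ N.rOut}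

/-- The area `|𝒜|`. -/
def area : ℝ := volume.real N.region

/-- The uniform distribution on the region: the law of one point of a binomial point process. -/
def uniformLaw : Measure ℂ := ProbabilityTheory.cond volume N.region

/-- Locations inside the line-of-sight ball. -/
def losBall : Set ℂ := {x | ‖x‖ ≤ N.rB}

theorem measurableSet_losBall : MeasurableSet N.losBall :=
  measurableSet_le measurable_norm measurable_const

open Classical in
/-- Nakagami factor of an interferer at `x`. -/
def nakagami (x : ℂ) : ℝ := if x ∈ N.losBall then N.mL else N.mN

open Classical in
/-- Path-loss exponent of an interferer at `x`. -/
def pathLoss (x : ℂ) : ℝ := if x ∈ N.losBall then N.αL else N.αN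

open Classical in
/-- Conditional law of the fading power gain of an interferer, given its location: the gamma
distribution of unit mean whose shape is the Nakagami factor. -/
def fadingKernel : Kernel ℂ ℝ :=
  Kernel.piecewise N.measurableSet_losBall
    (Kernel.const ℂ (gammaMeasure N.mL N.mL)) (Kernel.const ℂ (gammaMeasure N.mN N.mN))

/-- Probability that the reference receiver lies in the main lobe of an interferer. -/
def pM : ℝ := N.θta / (2 * Real.pi) * Real.sin (N.θte / 2)

/-- Law of the relative power radiated by an interferer towards the receiver: `0`, `G_t`, `g_t`
with probabilities `1 - p_t`, `p_t p_M`, `p_t (1 - p_M)`. -/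
def gainLaw : Measure ℝ :=
  ENNReal.ofReal (1 - N.pt) • Measure.dirac 0
    + ENNReal.ofReal (N.pt * N.pM) • Measure.dirac N.Gt
    + ENNReal.ofReal (N.pt * (1 - N.pM)) • Measure.dirac N.gt

/-- `a_i`, the factor of the power gain in the main lobe of the receiver. -/
def a (i : Fin K) : ℝ := N.P i / N.P₀ * N.Gr

/-- `b_i`, the factor of the power gain in the side lobe of the receiver. -/
def b (i : Fin K) : ℝ := N.P i / N.P₀ * N.gr

open Classical in
/-- Normalized power gain `Ω_i` of the `i`-th interferer located at `x`. The argument of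
`x e^{-jφ₀}` is the azimuth relative to the reference transmitter, reduced to `(-π, π]`. -/
def powerGain (i : Fin K) (x : ℂ) : ℝ :=
  (if |Complex.arg (x * Complex.exp (-(N.φ₀ : ℂ) * Complex.I))| ≤ N.θra / 2 then N.a i else N.b i)
    * ‖x‖ ^ (-N.pathLoss x)

/-- Normalized power gain `Ω₀` of the reference transmitter. -/
def powerGain₀ : ℝ := N.Gr * N.R₀ ^ (-N.α₀)

/-- The SINR for locations `x`, relative powers `I`, fading gains `h` and reference fading `h₀`. -/
def sinr (h₀ : ℝ) (x : Fin K → ℂ) (I h : Fin K → ℝ) : ℝ :=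
  N.Gt * h₀ * N.powerGain₀ / (N.noise + ∑ i, I i * h i * N.powerGain i (x i))

/-- The constant `β₀ = β m₀ / (G_t Ω₀)`. -/
def beta₀ (β : ℝ) : ℝ := β * N.m₀ / (N.Gt * N.powerGain₀)

/-! ### The functions in the closed form -/

/-- The function `𝒬_t(x)`, for Nakagami factor `m` and power gain `w`. -/
def Q (β : ℝ) (t : ℕ) (m w x : ℝ) : ℝ :=
  x ^ t * (1 + N.beta₀ β * x * w / m) ^ (-(m + t))

/-- The function `𝒢_t(w)`, for Nakagami factor `m` and power gain `w`. -/
def G (β : ℝ) (t : ℕ) (m w : ℝ) : ℝ :=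
  N.pt * (w / m) ^ t * (Real.Gamma (m + t) / (t.factorial * Real.Gamma m))
      * (N.pM * N.Q β t m w N.Gt + (1 - N.pM) * N.Q β t m w N.gt)
    + (1 - N.pt) * (if t = 0 then 1 else 0)

/-- The density piece `𝒟(w; [w₁, w₂]; c; α)`. -/
def D (w w₁ w₂ c α : ℝ) : ℝ :=
  (Icc w₁ w₂).indicator
    (fun w => 2 * Real.pi * w ^ (-((2 + α) / α)) / (α * N.area) * c ^ (2 / α)) w

/-- The coefficient `𝒦_t(α, c)`, for Nakagami factor `m`. -/
def Kcoef (β : ℝ) (t : ℕ) (m α c : ℝ) : ℝ :=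
  2 * Real.pi * m ^ m * Real.Gamma (m + t) * N.beta₀ β ^ (-(m + t)) * c ^ (2 / α)
    / (Real.Gamma m * N.area * t.factorial * α)

/-- The function `ℳ_t(x; α)`, for Nakagami factor `m`. -/
def M (β : ℝ) (t : ℕ) (m x α : ℝ) : ℝ :=
  gauss2F1 (m + t) (m + 2 / α) (m + 2 / α + 1) (-(m / (x * N.beta₀ β)))
    / (x ^ m * (m + 2 / α))

/-- The closed form of `∫₀^∞ 𝒟(w; [w₁, w₂]; c; α) 𝒢_t(w) dw`, for Nakagami factor `m`. -/
def T (β : ℝ) (t : ℕ) (m w₁ w₂ c α : ℝ) : ℝ :=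
  (1 - N.pt) * (Real.pi * c ^ (2 / α) / N.area) * (1 / w₁ ^ (2 / α) - 1 / w₂ ^ (2 / α))
      * (if t = 0 then 1 else 0)
    + N.pt * N.Kcoef β t m α c *
      (N.pM * (N.M β t m (N.Gt * w₁) α / w₁ ^ (2 / α) - N.M β t m (N.Gt * w₂) α / w₂ ^ (2 / α))
        + (1 - N.pM) *
          (N.M β t m (N.gt * w₁) α / w₁ ^ (2 / α) - N.M β t m (N.gt * w₂) α / w₂ ^ (2 / α)))

/-- Line-of-sight plus non-line-of-sight contribution, for receiver factor `c` (`a_i` or `b_i`). -/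
def sectorTerm (β : ℝ) (t : ℕ) (c : ℝ) : ℝ :=
  N.T β t N.mL (c / N.rB ^ N.αL) (c / N.rIn ^ N.αL) c N.αL
    + N.T β t N.mN (c / N.rOut ^ N.αN) (c / N.rB ^ N.αN) c N.αN

/-- The closed form of `𝔼[𝒢_t(Ω_i)]`. -/
def meanG (β : ℝ) (i : Fin K) (t : ℕ) : ℝ :=
  N.θra / (2 * Real.pi) * N.sectorTerm β t (N.a i)
    + (1 - N.θra / (2 * Real.pi)) * N.sectorTerm β t (N.b i)

/-- The product form of the coverage probability, with `g i t` in the place of `𝒢_t(Ω_i)` or of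
its mean. The innermost sum is over the sequences of `K` natural numbers with sum `t`. -/
def productForm (β : ℝ) (g : Fin K → ℕ → ℝ) : ℝ :=
  Real.exp (-(N.beta₀ β * N.noise)) *
    ∑ l ∈ Finset.range N.m₀, (N.beta₀ β * N.noise) ^ l / l.factorial *
      ∑ t ∈ Finset.range (l + 1), (l.choose t : ℝ) * (t.factorial / N.noise ^ t) *
        ∑ τ ∈ Finset.piAntidiag (Finset.univ : Finset (Fin K)) t, ∏ i, g i (τ i)

/-- The line-of-sight ball model on a probability space: `X i` is the location of the `i`-th
interferer, `I i` its relative radiated power, `h i` its fading gain, and `h₀` the fading gain of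
the reference link. -/
structure IsLOSBallModel {S : Type*} [MeasurableSpace S] (μ : Measure S)
    (X : Fin K → S → ℂ) (I h : Fin K → S → ℝ) (h₀ : S → ℝ) : Prop where
  measurable_X : ∀ i, Measurable (X i)
  measurable_I : ∀ i, Measurable (I i)
  measurable_h : ∀ i, Measurable (h i)
  measurable_h₀ : Measurable h₀
  /-- The location is uniform and, given the location, the fading is gamma distributed. -/
  law_location_fading : ∀ i, HasLaw (fun s => (X i s, h i s)) (N.uniformLaw ⊗ₘ N.fadingKernel) μ
  law_gain : ∀ i, HasLaw (I i) N.gainLaw μ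
  law_h₀ : HasLaw h₀ (gammaMeasure N.m₀ N.m₀) μ
  /-- The radiated power of an interferer is independent of its location and fading. -/
  indep_gain : ∀ i, IndepFun (I i) (fun s => (X i s, h i s)) μ
  /-- Different interferers are independent. -/
  indep_interferers : iIndepFun (fun i s => (X i s, I i s, h i s)) μ
  /-- The reference link is independent of all interferers. -/
  indep_h₀ : IndepFun h₀ (fun s i => (X i s, I i s, h i s)) μ

end

end Network

end MmWave

/-!
Coverage means that the reference fading gain exceeds the threshold `β (σ² + Y) / (G_t Ω₀)`, where
`Y = ∑ I_i h_i Ω_i` is the interference. Since `h₀` is independent of `Y` and gamma distributed with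
integer shape `m₀`, its tail is `e^{-u} ∑_{l < m₀} u ^ l / l!` at `u = β₀ (σ² + Y)`
(`gammaMeasure_real_Ioi`). The binomial theorem reduces the coverage probability to the tilted
moments `𝔼[Y ^ t e^{-β₀ Y}]`, the multinomial theorem and the independence of the interferers reduce
these to products of `𝔼[Y_i ^ t e^{-β₀ Y_i}]`, and integrating out the fading and the radiated
power turns such a factor into `t! 𝔼[𝒢_t(Ω_i)]` (`IsLOSBallModel.integral_tiltedPower`). The
binomial and multinomial coefficients supply the combinatorial factors of the product form. The
tilted moments are finite because `y ^ t e^{-b y} ≤ t! / b ^ t`.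

For the closed form, Euler's integral `b ∫₀¹ s^{b-1} (1 - z s)^{-a} ds` is real-analytic on
`(-∞, 1)`, being the restriction of a function holomorphic on `re z < 1`, and it agrees with the
Gauss series for `₂F₁(a, b; b + 1; z)` on the unit disc, so it is the continuation of that series
(`gauss2F1_eq_eulerIntegral`). Hence `z^b ₂F₁(a, b; b + 1; -z) / b` is a primitive of
`z^{b-1} (1 + z)^{-a}`, and `z = m / (g w β₀)` makes `ℳ_t(g w) / w^{2/α}` a primitive of the
integrand `𝒟 𝒢_t` in `w`, up to sign and a constant factor (`hasDerivAt_primitiveT`). The integral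
formula is then the fundamental theorem of calculus. The expectation over a uniform location splits
in polar coordinates into an angular factor, which is the beamwidth of the receiver or its
complement, and a radial integral. The latter is evaluated by the same primitive along
`w = c r^{-α}`, separately inside and outside the line-of-sight ball.
-/

/-! ### The Gauss hypergeometric function as Euler's integral -/

namespace MmWave

/-- Euler's integral for `₂F₁(a, b; b + 1; z)`. -/
noncomputable def eulerIntegral (a b z : ℝ) : ℝ :=
  b * ∫ s in (0 : ℝ)..1, s ^ (b - 1) * (1 - z * s) ^ (-a)

theorem one_sub_mul_re_pos {z : ℂ} (hz : z.re < 1) {s : ℝ} (hs : s ∈ Icc (0 : ℝ) 1) :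
    0 < (1 - z * s).re := by
  simp only [Complex.sub_re, Complex.one_re, Complex.mul_re, Complex.ofReal_re, Complex.ofReal_im,
    mul_zero, sub_zero]
  rcases le_or_gt z.re 0 with h | h
  · nlinarith [hs.1, hs.2]
  · nlinarith [hs.1, hs.2]

theorem one_sub_mul_mem_slitPlane {z : ℂ} (hz : z.re < 1) {s : ℝ} (hs : s ∈ Icc (0 : ℝ) 1) :
    1 - z * s ∈ Complex.slitPlane :=
  Or.inl (one_sub_mul_re_pos hz hs)

theorem continuousOn_one_sub_mul_cpow {z : ℂ} (hz : z.re < 1) (e : ℂ) :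
    ContinuousOn (fun s : ℝ => (1 - z * s) ^ e) (Icc 0 1) :=
  ContinuousOn.cpow_const (by fun_prop) fun _ hs => one_sub_mul_mem_slitPlane hz hs

/-- The integrand may be singular at `s = 0`, but only as `s ^ (b - 1)` with `b - 1 > -1`. -/
theorem intervalIntegrable_rpow_mul_cpow {b : ℝ} (hb : 0 < b) {z : ℂ} (hz : z.re < 1) (e : ℂ) :
    IntervalIntegrable (fun s : ℝ => ((s ^ (b - 1) : ℝ) : ℂ) * (1 - z * s) ^ e) volume 0 1 := by
  have h : IntervalIntegrable (fun s : ℝ => s ^ (b - 1)) volume 0 1 :=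
    intervalIntegral.intervalIntegrable_rpow' (by linarith)
  have h' : IntervalIntegrable (fun s : ℝ => ((s ^ (b - 1) : ℝ) : ℂ)) volume 0 1 :=
    ⟨h.1.ofReal, h.2.ofReal⟩
  refine h'.mul_continuousOn ?_
  rw [uIcc_of_le zero_le_one]
  exact continuousOn_one_sub_mul_cpow hz e

/-- Euler's integral with complex argument is holomorphic on the half-plane `re z < 1`. -/
theorem differentiableOn_complex_eulerIntegral (a : ℝ) {b : ℝ} (hb : 0 < b) :
    DifferentiableOn ℂ
      (fun z : ℂ => ∫ s in (0 : ℝ)..1, ((s ^ (b - 1) : ℝ) : ℂ) * (1 - z * s) ^ (-a : ℂ))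
      {z | z.re < 1} := by
  intro z₀ hz₀
  have hz₀ : z₀.re < 1 := hz₀
  set ε : ℝ := (1 - z₀.re) / 2 with hε
  have hε0 : 0 < ε := by rw [hε]; linarith
  have hre : ∀ z ∈ Metric.closedBall z₀ ε, z.re < 1 := by
    intro z hz
    have h1 : |(z - z₀).re| ≤ ‖z - z₀‖ := Complex.abs_re_le_norm _
    have h2 : ‖z - z₀‖ ≤ ε := by simpa [dist_eq_norm] using hz
    have h3 := (abs_le.mp (h1.trans h2)).2
    rw [Complex.sub_re] at h3
    linarith
  -- up to the factor `s ^ (b - 1)`, the derivative of the integrand is bounded near `z₀`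
  have hcont : ContinuousOn (fun p : ℂ × ℝ => (1 - p.1 * p.2) ^ (-a - 1 : ℂ))
      (Metric.closedBall z₀ ε ×ˢ Icc (0 : ℝ) 1) :=
    ContinuousOn.cpow_const (by fun_prop) fun p hp => one_sub_mul_mem_slitPlane (hre _ hp.1) hp.2
  obtain ⟨C, hC⟩ := ((isCompact_closedBall z₀ ε).prod isCompact_Icc).exists_bound_of_continuousOn
    hcont
  have hsub : uIoc (0 : ℝ) 1 ⊆ Icc 0 1 := by
    rw [uIoc_of_le zero_le_one]; exact Ioc_subset_Icc_self
  refine (intervalIntegral.hasDerivAt_integral_of_dominated_loc_of_deriv_le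
    (F' := fun z s => ((s ^ (b - 1) : ℝ) : ℂ) * ((a * s : ℂ) * (1 - z * s) ^ (-a - 1 : ℂ)))
    (bound := fun s => s ^ (b - 1) * (|a| * C)) (Metric.closedBall_mem_nhds z₀ hε0)
    ?_ (intervalIntegrable_rpow_mul_cpow hb hz₀ _)
    ?_ ?_ ?_ ?_).2.differentiableAt.differentiableWithinAt
  · filter_upwards [Metric.closedBall_mem_nhds z₀ hε0] with z hz
    exact (intervalIntegrable_iff.mp
      (intervalIntegrable_rpow_mul_cpow hb (hre z hz) _)).aestronglyMeasurable
  · have h := (intervalIntegrable_rpow_mul_cpow hb hz₀ (-a - 1 : ℂ)).continuousOn_mul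
      (g := fun s : ℝ => (a * s : ℂ)) (by fun_prop)
    refine (intervalIntegrable_iff.mp h).aestronglyMeasurable.congr ?_
    exact Filter.Eventually.of_forall fun s => by ring
  · refine Filter.Eventually.of_forall fun s hs z hz => ?_
    have hs' := hsub hs
    rw [norm_mul, norm_mul, norm_mul, Complex.norm_real, Complex.norm_real, Complex.norm_real,
      Real.norm_of_nonneg (Real.rpow_nonneg hs'.1 _), Real.norm_of_nonneg hs'.1, Real.norm_eq_abs]
    have h1 := hC (z, s) ⟨hz, hs'⟩
    have h2 : |a| * s ≤ |a| := mul_le_of_le_one_right (abs_nonneg a) hs'.2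
    exact mul_le_mul_of_nonneg_left
      (mul_le_mul h2 h1 (norm_nonneg _) (abs_nonneg a)) (Real.rpow_nonneg hs'.1 _)
  · exact (intervalIntegral.intervalIntegrable_rpow' (by linarith)).mul_const _
  · refine Filter.Eventually.of_forall fun s hs z hz => ?_
    have h1 : HasDerivAt (fun z : ℂ => 1 - z * s) (-(s : ℂ)) z := by
      simpa using ((hasDerivAt_id z).mul_const (s : ℂ)).const_sub 1
    have h2 := (h1.cpow_const (c := (-a : ℂ))
      (one_sub_mul_mem_slitPlane (hre z hz) (hsub hs))).const_mul ((s ^ (b - 1) : ℝ) : ℂ)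
    exact h2.congr_deriv (by ring)

/-- Euler's integral is the real part of its complex version at real arguments. -/
theorem analyticOnNhd_eulerIntegral (a : ℝ) {b : ℝ} (hb : 0 < b) :
    AnalyticOnNhd ℝ (eulerIntegral a b) (Iio 1) := by
  intro x hx
  have hopen : IsOpen {z : ℂ | z.re < 1} := isOpen_lt Complex.continuous_re continuous_const
  have h1 := ((differentiableOn_complex_eulerIntegral a hb).analyticOnNhd hopen (x : ℂ)
    (by simpa using hx)).restrictScalars (𝕜 := ℝ)
  have h2 := (Complex.reCLM.analyticAt _).comp (h1.comp (Complex.ofRealCLM.analyticAt x))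
  refine (analyticAt_const (v := b)).mul (h2.congr ?_)
  filter_upwards [Iio_mem_nhds hx] with y hy
  have hy : y < 1 := hy
  have h3 : ∫ s in (0 : ℝ)..1, ((s ^ (b - 1) : ℝ) : ℂ) * (1 - (y : ℂ) * s) ^ (-a : ℂ)
      = ((∫ s in (0 : ℝ)..1, s ^ (b - 1) * (1 - y * s) ^ (-a) : ℝ) : ℂ) := by
    rw [← intervalIntegral.integral_ofReal]
    refine intervalIntegral.integral_congr fun s hs => ?_
    rw [uIcc_of_le zero_le_one] at hs
    have h4 := one_sub_mul_re_pos (z := y) (by simpa using hy) hs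
    have h5 : 0 ≤ 1 - y * s := by
      rw [show (1 - (y : ℂ) * s) = ((1 - y * s : ℝ) : ℂ) by push_cast; ring,
        Complex.ofReal_re] at h4
      exact h4.le
    have := Complex.ofReal_cpow h5 (-a)
    push_cast at this ⊢
    rw [this]
  simp only [Function.comp_apply, Complex.reCLM_apply]
  rw [h3, Complex.ofReal_re]

/-- The coefficients of the binomial series, in terms of rising factorials. -/
theorem ringChoose_neg_eq (a : ℝ) (n : ℕ) :
    Ring.choose (-a) n = (-1) ^ n * ((n.factorial : ℝ)⁻¹ * (ascPochhammer ℝ n).eval a) := by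
  rw [Ring.choose_eq_smul]
  simp only [Polynomial.descPochhammer_smeval_eq_ascPochhammer,
    Polynomial.ascPochhammer_smeval_cast, Polynomial.ascPochhammer_smeval_eq_eval]
  have h := ascPochhammer_eval_neg_eq_descPochhammer ℝ (-a) n
  rw [neg_neg] at h
  rw [← descPochhammer_eval_eq_ascPochhammer, h, smul_eq_mul]
  have : ((-1 : ℝ) ^ n) * (-1) ^ n = 1 := by rw [← mul_pow]; simp
  linear_combination (-(n.factorial : ℝ)⁻¹ * Polynomial.eval (-a) (descPochhammer ℝ n)) * this

/-- The ratio `(b)_n / (b + 1)_n` is `b / (b + n)`. -/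
theorem mul_ascPochhammer_eval_add_one (b : ℝ) (n : ℕ) :
    b * (ascPochhammer ℝ n).eval (b + 1) = (ascPochhammer ℝ n).eval b * (b + n) := by
  have h1 := congrArg (Polynomial.eval b) (ascPochhammer_succ_left ℝ n)
  have h2 := congrArg (Polynomial.eval b) (ascPochhammer_succ_right ℝ n)
  simp only [Polynomial.eval_mul, Polynomial.eval_X, Polynomial.eval_comp, Polynomial.eval_add,
    Polynomial.eval_one, Polynomial.eval_natCast] at h1 h2
  rw [← h1, h2]

/-- On the unit disc Euler's integral is the Gauss series: integrate the binomial series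
termwise. -/
theorem eulerIntegral_eq_ordinaryHypergeometric (a : ℝ) {b : ℝ} (hb : 0 < b) {z : ℝ}
    (hz : |z| < 1) : eulerIntegral a b z = ordinaryHypergeometric a b (b + 1) z := by
  have hsub : uIoc (0 : ℝ) 1 = Ioc 0 1 := uIoc_of_le zero_le_one
  have hsummable : Summable fun n : ℕ => ‖Ring.choose (-a) n‖ * |z| ^ n := by
    have := (binomialSeries ℝ (-a)).summable_norm_mul_pow (r := ‖z‖₊)
      (lt_of_lt_of_le (by simpa [← NNReal.coe_lt_one] using hz)
        (binomialSeries_radius_ge_one (𝕂 := ℝ) (a := -a)))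
    refine this.congr fun n => ?_
    rw [binomialSeries, FormalMultilinearSeries.ofScalars_norm, coe_nnnorm, Real.norm_eq_abs z]
  have hbin : ∀ s ∈ Ioc (0 : ℝ) 1,
      HasSum (fun n : ℕ => Ring.choose (-a) n * (-(z * s)) ^ n) ((1 - z * s) ^ (-a)) := by
    intro s hs
    have hzs : |z * s| < 1 := by
      rw [abs_mul, abs_of_pos hs.1]
      nlinarith [abs_nonneg z, hs.1, hs.2]
    have := (Real.one_add_rpow_hasFPowerSeriesOnBall_zero (a := -a)).hasSum (y := -(z * s))
      (by
        rw [Metric.mem_eball, edist_zero_right, enorm_neg, enorm_eq_nnnorm]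
        exact_mod_cast hzs)
    simp only [binomialSeries_apply, List.ofFn_const, List.prod_replicate, smul_eq_mul,
      zero_add] at this
    rwa [← sub_eq_add_neg] at this
  -- termwise integration, dominated by `s ^ (b - 1)` times the absolute series at `z`
  have h := intervalIntegral.hasSum_integral_of_dominated_convergence (μ := volume)
    (a := 0) (b := 1)
    (F := fun (n : ℕ) (s : ℝ) => s ^ (b - 1) * (Ring.choose (-a) n * (-(z * s)) ^ n))
    (f := fun s => s ^ (b - 1) * (1 - z * s) ^ (-a))
    (fun n s => s ^ (b - 1) * (‖Ring.choose (-a) n‖ * |z| ^ n))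
    (fun n => by fun_prop)
    (fun n => Filter.Eventually.of_forall fun s hs => by
      rw [hsub] at hs
      rw [norm_mul, norm_mul, Real.norm_of_nonneg (Real.rpow_nonneg hs.1.le _), norm_pow, norm_neg,
        Real.norm_eq_abs (z * s)]
      have : |z * s| ≤ |z| := by
        rw [abs_mul, abs_of_pos hs.1]; exact mul_le_of_le_one_right (abs_nonneg z) hs.2
      have := Real.rpow_nonneg hs.1.le (b - 1)
      gcongr)
    (Filter.Eventually.of_forall fun s _ => hsummable.mul_left _)
    (by
      simp_rw [tsum_mul_left]
      exact (intervalIntegral.intervalIntegrable_rpow' (by linarith)).mul_const _)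
    (Filter.Eventually.of_forall fun s hs => (hbin s (hsub ▸ hs)).mul_left _)
  rw [eulerIntegral, ← h.tsum_eq, ordinaryHypergeometric_eq_tsum, ← tsum_mul_left]
  refine tsum_congr fun n => ?_
  have hint : ∫ s in (0 : ℝ)..1, s ^ (b - 1) * (Ring.choose (-a) n * (-(z * s)) ^ n)
      = Ring.choose (-a) n * (-z) ^ n * (1 / (b + n)) := by
    have h1 : ∫ s in (0 : ℝ)..1, s ^ (b - 1) * (Ring.choose (-a) n * (-(z * s)) ^ n)
        = ∫ s in (0 : ℝ)..1, Ring.choose (-a) n * (-z) ^ n * s ^ (b - 1 + n) := by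
      refine intervalIntegral.integral_congr_ae (Filter.Eventually.of_forall fun s hs => ?_)
      rw [hsub] at hs
      rw [Real.rpow_add hs.1, Real.rpow_natCast, ← neg_mul, mul_pow]
      ring
    rw [h1, intervalIntegral.integral_const_mul,
      integral_rpow (Or.inl (by have : (0 : ℝ) ≤ n := n.cast_nonneg; linarith))]
    rw [show b - 1 + n + 1 = b + n by ring, Real.one_rpow,
      Real.zero_rpow (by positivity), sub_zero]
  rw [hint, ringChoose_neg_eq, smul_eq_mul]
  have hbn : b + n ≠ 0 := by positivity
  have hpos : (ascPochhammer ℝ n).eval (b + 1) ≠ 0 := (ascPochhammer_pos n _ (by linarith)).ne'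
  have hrel := mul_ascPochhammer_eval_add_one b n
  have hratio : (ascPochhammer ℝ n).eval b * ((ascPochhammer ℝ n).eval (b + 1))⁻¹
      = b / (b + n) := by
    rw [← div_eq_mul_inv, div_eq_div_iff hpos hbn, hrel]
  rw [mul_assoc _ (Polynomial.eval b _), hratio, neg_pow z]
  have : ((-1 : ℝ) ^ n) * (-1) ^ n = 1 := by rw [← mul_pow]; simp
  linear_combination (b * ((n.factorial : ℝ)⁻¹ * Polynomial.eval a (ascPochhammer ℝ n)) * z ^ n
    * (1 / (b + n))) * this

/-- The Gauss hypergeometric function with `c = b + 1` is Euler's integral on `(-∞, 1)`. -/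
theorem gauss2F1_eq_eulerIntegral (a : ℝ) {b : ℝ} (hb : 0 < b) {z : ℝ} (hz : z < 1) :
    gauss2F1 a b (b + 1) z = eulerIntegral a b z := by
  have h : IsGaussContinuation a b (b + 1) (eulerIntegral a b) :=
    ⟨analyticOnNhd_eulerIntegral a hb,
      fun z hz => eulerIntegral_eq_ordinaryHypergeometric a hb hz⟩
  exact (Classical.epsilon_spec (p := IsGaussContinuation a b (b + 1)) ⟨_, h⟩).eqOn h hz

/-- `z ^ b ₂F₁(a, b; b + 1; -z) / b` is a primitive of `z ^ (b - 1) (1 + z) ^ (-a)`. -/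
theorem hasDerivAt_rpow_mul_gauss2F1 (a : ℝ) {b : ℝ} (hb : 0 < b) {z : ℝ} (hz : 0 < z) :
    HasDerivAt (fun z => z ^ b * gauss2F1 a b (b + 1) (-z) / b)
      (z ^ (b - 1) * (1 + z) ^ (-a)) z := by
  -- the substitution `u = y s` turns Euler's integral into an integral over `[0, y]`
  have hrep : ∀ y : ℝ, 0 < y → y ^ b * gauss2F1 a b (b + 1) (-y) / b
      = ∫ u in (0 : ℝ)..y, u ^ (b - 1) * (1 + u) ^ (-a) := by
    intro y hy
    rw [gauss2F1_eq_eulerIntegral a hb (by linarith), eulerIntegral]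
    have h1 := intervalIntegral.integral_comp_mul_left (a := 0) (b := 1)
      (fun u : ℝ => u ^ (b - 1) * (1 + u) ^ (-a)) hy.ne'
    rw [mul_zero, mul_one, smul_eq_mul] at h1
    have h2 : ∫ s in (0 : ℝ)..1, (y * s) ^ (b - 1) * (1 + y * s) ^ (-a)
        = y ^ (b - 1) * ∫ s in (0 : ℝ)..1, s ^ (b - 1) * (1 - -y * s) ^ (-a) := by
      rw [← intervalIntegral.integral_const_mul]
      refine intervalIntegral.integral_congr fun s hs => ?_
      rw [uIcc_of_le zero_le_one] at hs
      rw [Real.mul_rpow hy.le hs.1, neg_mul, sub_neg_eq_add]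
      ring
    rw [h2, Real.rpow_sub_one hy.ne'] at h1
    field_simp at h1 ⊢
    linarith
  have hmeas : Measurable fun u : ℝ => u ^ (b - 1) * (1 + u) ^ (-a) := by fun_prop
  have hII : IntervalIntegrable (fun u : ℝ => u ^ (b - 1) * (1 + u) ^ (-a)) volume 0 z := by
    refine (intervalIntegral.intervalIntegrable_rpow' (by linarith)).mul_continuousOn ?_
    refine ContinuousOn.rpow_const (by fun_prop) fun u hu => Or.inl ?_
    rw [uIcc_of_le hz.le] at hu
    linarith [hu.1]
  have hc : ContinuousAt (fun u : ℝ => u ^ (b - 1) * (1 + u) ^ (-a)) z :=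
    (Real.continuousAt_rpow_const _ _ (Or.inl hz.ne')).mul
      (ContinuousAt.rpow_const (by fun_prop) (Or.inl (by positivity)))
  refine (intervalIntegral.integral_hasDerivAt_right hII
    hmeas.stronglyMeasurable.stronglyMeasurableAtFilter hc).congr_of_eventuallyEq ?_
  filter_upwards [Ioi_mem_nhds hz] with y hy using hrep y hy

end MmWave

/-! ### The closed form of the integral against the density piece -/

namespace MmWave
namespace Network

variable {K : ℕ} (N : Network K)

theorem powerGain₀_pos : 0 < N.powerGain₀ :=
  mul_pos N.Gr_pos (Real.rpow_pos_of_pos N.R₀_pos _)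

theorem beta₀_pos {β : ℝ} (hβ : 0 < β) : 0 < N.beta₀ β :=
  div_pos (mul_pos hβ (Nat.cast_pos.mpr N.m₀_pos)) (mul_pos N.Gt_pos N.powerGain₀_pos)

/-- The chain rule for the primitive `z ^ b ₂F₁(a, b; b + 1; -z) / b` at `z = m / (g w β₀)`, with
`a = m + t` and `b = m + 2 / α`. -/
theorem hasDerivAt_M_div_rpow {β : ℝ} (hβ : 0 < β) (t : ℕ) {m α g w : ℝ} (hm : 0 < m)
    (hα : 0 < α) (hg : 0 < g) (hw : 0 < w) :
    HasDerivAt (fun w => N.M β t m (g * w) α / w ^ (2 / α))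
      (-((N.beta₀ β / m) ^ (m + t) * w ^ t * w ^ (-((2 + α) / α)) * N.Q β t m w g)) w := by
  have hB := N.beta₀_pos hβ
  set B := N.beta₀ β with hBdef
  set b : ℝ := m + 2 / α with hb
  have hb0 : 0 < b := by positivity
  set κ : ℝ := m / (g * B) with hκ
  have hκ0 : 0 < κ := by positivity
  have hz : HasDerivAt (fun w : ℝ => κ / w) (-κ / w ^ 2) w := by
    simpa [div_eq_mul_inv] using (hasDerivAt_inv hw.ne').const_mul κ
  have h1 := ((hasDerivAt_rpow_mul_gauss2F1 (m + t) hb0 (div_pos hκ0 hw)).comp w hz).const_mul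
    (g ^ (-m) * κ ^ (-b))
  have h2 : HasDerivAt (fun w => N.M β t m (g * w) α / w ^ (2 / α))
      (g ^ (-m) * κ ^ (-b) * ((κ / w) ^ (b - 1) * (1 + κ / w) ^ (-(m + t)) * (-κ / w ^ 2))) w := by
    refine h1.congr_of_eventuallyEq ?_
    filter_upwards [Ioi_mem_nhds hw] with y hy
    have hy : 0 < y := hy
    have e1 : m / (g * y * B) = κ / y := by rw [hκ]; field_simp
    rw [M, ← hBdef, ← hb, e1]
    simp only [Function.comp_apply]
    rw [Real.div_rpow hκ0.le hy.le, Real.rpow_neg hg.le, Real.rpow_neg hκ0.le,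
      Real.mul_rpow hg.le hy.le, show y ^ b = y ^ m * y ^ (2 / α) by rw [hb, Real.rpow_add hy]]
    have := Real.rpow_pos_of_pos hκ0 b
    have := Real.rpow_pos_of_pos hg m
    have := Real.rpow_pos_of_pos hy m
    have := Real.rpow_pos_of_pos hy (2 / α)
    field_simp
  refine h2.congr_deriv ?_
  have e2 : 1 + κ / w = κ / w * (1 + B * g * w / m) := by
    rw [hκ]; field_simp; ring
  have e3 : B / m = κ⁻¹ / g := by rw [hκ]; field_simp
  have hκw : 0 < κ / w := div_pos hκ0 hw
  have hp : 0 < 1 + B * g * w / m := by positivity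
  rw [Q, ← hBdef, e2, Real.mul_rpow hκw.le hp.le, e3, Real.div_rpow (by positivity) hg.le,
    Real.inv_rpow hκ0.le, Real.rpow_add_natCast hg.ne', Real.rpow_neg hκw.le,
    Real.rpow_add_natCast hκw.ne', Real.rpow_sub_one hκw.ne', Real.rpow_add_natCast hκ0.ne',
    Real.rpow_neg hg.le, Real.rpow_neg hκ0.le, Real.div_rpow hκ0.le hw.le,
    Real.div_rpow hκ0.le hw.le,
    show -((2 + α) / α) = -(2 / α) - 1 by field_simp; ring, Real.rpow_sub_one hw.ne',
    Real.rpow_neg hw.le, show w ^ b = w ^ m * w ^ (2 / α) by rw [hb, Real.rpow_add hw]]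
  generalize (1 + B * g * w / m) ^ (-(m + (t : ℝ))) = q
  have := Real.rpow_pos_of_pos hκ0 b
  have := Real.rpow_pos_of_pos hκ0 m
  have := Real.rpow_pos_of_pos hg m
  have := Real.rpow_pos_of_pos hw m
  have := Real.rpow_pos_of_pos hw (2 / α)
  rw [div_pow]
  field_simp

/-- A primitive on `(0, ∞)`, up to sign, of the integrand whose closed form is `T`. The value `T`
is the difference of its values at the lower and the upper end. -/
noncomputable def primitiveT (β : ℝ) (t : ℕ) (m c α w : ℝ) : ℝ :=
  (1 - N.pt) * (Real.pi * c ^ (2 / α) / N.area) * (1 / w ^ (2 / α)) * (if t = 0 then 1 else 0)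
    + N.pt * N.Kcoef β t m α c *
      (N.pM * (N.M β t m (N.Gt * w) α / w ^ (2 / α))
        + (1 - N.pM) * (N.M β t m (N.gt * w) α / w ^ (2 / α)))

theorem T_eq_sub (β : ℝ) (t : ℕ) (m w₁ w₂ c α : ℝ) :
    N.T β t m w₁ w₂ c α = N.primitiveT β t m c α w₁ - N.primitiveT β t m c α w₂ := by
  unfold T primitiveT
  ring

theorem hasDerivAt_primitiveT {β : ℝ} (hβ : 0 < β) (t : ℕ) {m α w : ℝ} (c : ℝ) (hm : 0 < m)
    (hα : 0 < α) (hw : 0 < w) :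
    HasDerivAt (N.primitiveT β t m c α)
      (-(2 * Real.pi * w ^ (-((2 + α) / α)) / (α * N.area) * c ^ (2 / α) * N.G β t m w)) w := by
  have hB := N.beta₀_pos hβ
  have h1 : HasDerivAt (fun w : ℝ => 1 / w ^ (2 / α)) (-(2 / α) * w ^ (-((2 + α) / α))) w := by
    have h := Real.hasDerivAt_rpow_const (x := w) (p := -(2 / α)) (Or.inl hw.ne')
    rw [show -(2 / α) - 1 = -((2 + α) / α) by field_simp; ring] at h
    refine h.congr_of_eventuallyEq ?_
    filter_upwards [Ioi_mem_nhds hw] with y hy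
    rw [Real.rpow_neg (le_of_lt hy), one_div]
  have h2 := ((h1.const_mul ((1 - N.pt) * (Real.pi * c ^ (2 / α) / N.area))).mul_const
    (if t = 0 then 1 else 0 : ℝ)).add
    ((((N.hasDerivAt_M_div_rpow hβ t hm hα N.Gt_pos hw).const_mul N.pM).add
      ((N.hasDerivAt_M_div_rpow hβ t hm hα N.gt_pos hw).const_mul (1 - N.pM))).const_mul
        (N.pt * N.Kcoef β t m α c))
  refine h2.congr_deriv ?_
  have hK : N.Kcoef β t m α c * (N.beta₀ β / m) ^ (m + t)
      = 2 * Real.pi / (α * N.area) * c ^ (2 / α)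
        * ((1 / m ^ t) * (Real.Gamma (m + t) / (t.factorial * Real.Gamma m))) := by
    unfold Kcoef
    rw [Real.div_rpow hB.le hm.le, Real.rpow_neg hB.le, Real.rpow_add_natCast hm.ne']
    have := Real.rpow_pos_of_pos hB (m + t)
    have := Real.rpow_pos_of_pos hm m
    have := Real.Gamma_pos_of_pos hm
    -- a vanishing area would make both sides `0`, so its positivity is not needed
    rcases eq_or_ne N.area 0 with hA | hA
    · simp [hA]
    · field_simp
  unfold G
  rw [div_pow]
  linear_combination (-(N.pt * w ^ t * w ^ (-((2 + α) / α)) *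
    (N.pM * N.Q β t m w N.Gt + (1 - N.pM) * N.Q β t m w N.gt))) * hK

theorem continuousOn_G {β : ℝ} (hβ : 0 < β) (t : ℕ) {m : ℝ} (hm : 0 < m) :
    ContinuousOn (N.G β t m) (Ioi 0) := by
  have hB := N.beta₀_pos hβ
  have hQ : ∀ g, 0 < g → ContinuousOn (fun w => N.Q β t m w g) (Ioi 0) := by
    intro g hg
    refine continuousOn_const.mul (ContinuousOn.rpow_const (by fun_prop) fun w hw => Or.inl ?_)
    have : (0 : ℝ) < w := hw
    positivity
  have := hQ _ N.Gt_pos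
  have := hQ _ N.gt_pos
  unfold G
  fun_prop

/-- The integral of the density piece against `𝒢_t` over the image interval. -/
theorem integrableOn_and_integral_D_mul_G {β : ℝ} (hβ : 0 < β) (t : ℕ) {m α w₁ w₂ : ℝ} (c : ℝ)
    (hm : 0 < m) (hα : 0 < α) (hw₁ : 0 < w₁) (hw : w₁ ≤ w₂) :
    IntegrableOn (fun w => N.D w w₁ w₂ c α * N.G β t m w) (Ioi 0) ∧
      ∫ w in Ioi 0, N.D w w₁ w₂ c α * N.G β t m w = N.T β t m w₁ w₂ c α := by
  set f : ℝ → ℝ := fun w =>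
    2 * Real.pi * w ^ (-((2 + α) / α)) / (α * N.area) * c ^ (2 / α) * N.G β t m w with hf
  have hD : (fun w => N.D w w₁ w₂ c α * N.G β t m w) = (Icc w₁ w₂).indicator f := by
    ext w
    by_cases h : w ∈ Icc w₁ w₂ <;> simp [D, h, hf]
  have hsub : Icc w₁ w₂ ⊆ Ioi 0 := fun w h => hw₁.trans_le h.1
  have hcont : ContinuousOn f (Icc w₁ w₂) := by
    have h1 : ContinuousOn (fun w : ℝ => w ^ (-((2 + α) / α))) (Icc w₁ w₂) :=
      ContinuousOn.rpow_const continuousOn_id fun w h => Or.inl (hsub h).ne'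
    have h2 := (N.continuousOn_G hβ t hm).mono hsub
    exact (((continuousOn_const.mul h1).div_const _).mul_const _).mul h2
  have hint : IntegrableOn f (Icc w₁ w₂) := hcont.integrableOn_Icc
  rw [hD]
  refine ⟨(hint.integrable_indicator measurableSet_Icc).integrableOn, ?_⟩
  rw [setIntegral_indicator measurableSet_Icc, inter_eq_right.mpr hsub,
    integral_Icc_eq_integral_Ioc, ← intervalIntegral.integral_of_le hw]
  have hder : ∀ w ∈ uIcc w₁ w₂, HasDerivAt (fun w => -N.primitiveT β t m c α w) (f w) w := by
    intro w h
    rw [uIcc_of_le hw] at h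
    exact (N.hasDerivAt_primitiveT hβ t c hm hα (hsub h)).neg.congr_deriv (neg_neg _)
  rw [intervalIntegral.integral_eq_sub_of_hasDerivAt hder
    ((intervalIntegrable_iff_integrableOn_Icc_of_le hw).mpr hint), T_eq_sub]
  ring

end Network
end MmWave

/-! ### The mean over a uniform location -/

namespace MmWave

/-- Integration of an angular times a radial function in polar coordinates. The product form needs
no integrability assumption. -/
theorem integral_arg_mul_norm (u F : ℝ → ℝ) :
    ∫ x : ℂ, u (Complex.arg x) * F ‖x‖
      = (∫ φ in Ioo (-Real.pi) Real.pi, u φ) * ∫ r in Ioi (0 : ℝ), r * F r := by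
  rw [← Complex.integral_comp_polarCoord_symm, mul_comm (∫ φ in Ioo (-Real.pi) Real.pi, u φ),
    ← setIntegral_prod_mul]
  refine setIntegral_congr_fun (measurableSet_Ioi.prod measurableSet_Ioo) fun p hp => ?_
  have hp1 : (0 : ℝ) < p.1 := hp.1
  have harg : Complex.arg (Complex.polarCoord.symm p) = p.2 := by
    rw [Complex.polarCoord_symm_apply, Complex.ofReal_cos, Complex.ofReal_sin]
    exact Complex.arg_mul_cos_add_sin_mul_I hp1 (Ioo_subset_Ioc_self hp.2)
  simp only [harg, Complex.norm_polarCoord_symm, abs_of_pos hp1, smul_eq_mul]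
  ring

/-- Measuring the angle from the direction `φ₀` does not change the integral, because rotations
preserve the area. -/
theorem integral_arg_rotate_mul_norm (φ₀ : ℝ) (u F : ℝ → ℝ) :
    ∫ x : ℂ, u (Complex.arg (x * Complex.exp (-(φ₀ : ℂ) * Complex.I))) * F ‖x‖
      = (∫ φ in Ioo (-Real.pi) Real.pi, u φ) * ∫ r in Ioi (0 : ℝ), r * F r := by
  rw [← integral_arg_mul_norm]
  set e := rotation (Circle.exp (-φ₀)) with he
  have h := e.measurePreserving.integral_comp e.toHomeomorph.measurableEmbedding
    (fun x : ℂ => u (Complex.arg x) * F ‖x‖)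
  rw [← h]
  congr 1
  ext x
  have : e x = x * Complex.exp (-(φ₀ : ℂ) * Complex.I) := by
    rw [he, rotation_apply, Circle.coe_exp, mul_comm]
    push_cast
    rfl
  rw [e.norm_map, this]

/-- The angles within `θ / 2` of the reference direction have total measure `θ`, also when
`θ / 2 = π`: endpoints do not matter. -/
theorem integral_indicator_abs_le {θ : ℝ} (hθ : θ ∈ Icc 0 (2 * Real.pi)) :
    ∫ φ in Ioo (-Real.pi) Real.pi, {φ | |φ| ≤ θ / 2}.indicator (fun _ => (1 : ℝ)) φ = θ := by
  have hm : MeasurableSet {φ : ℝ | |φ| ≤ θ / 2} := measurableSet_le (by fun_prop) measurable_const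
  rw [setIntegral_indicator hm, setIntegral_const, smul_eq_mul, mul_one]
  refine le_antisymm ?_ ?_
  · calc volume.real (Ioo (-Real.pi) Real.pi ∩ {φ | |φ| ≤ θ / 2})
        ≤ volume.real (Icc (-(θ / 2)) (θ / 2)) :=
          measureReal_mono (fun φ h => abs_le.mp h.2) (by simp)
      _ = θ := by rw [Real.volume_real_Icc_of_le (by linarith [hθ.1])]; ring
  · calc θ = volume.real (Ioo (-(θ / 2)) (θ / 2)) := by
          rw [Real.volume_real_Ioo_of_le (by linarith [hθ.1])]; ring
      _ ≤ volume.real (Ioo (-Real.pi) Real.pi ∩ {φ | |φ| ≤ θ / 2}) :=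
          measureReal_mono
            (fun φ h => ⟨⟨by linarith [h.1, hθ.2], by linarith [h.2, hθ.2]⟩,
              abs_le.mpr ⟨h.1.le, h.2.le⟩⟩)
            (ne_top_of_le_ne_top (by simp) (measure_mono inter_subset_left))

namespace Network

variable {K : ℕ} (N : Network K)

/-- `𝒢_t(c r^{-α})` as a function of the distance `r`, with the Nakagami factor `m` and the
path-loss exponent `α` of a location at distance `r`. -/
noncomputable def radialG (β : ℝ) (t : ℕ) (c r : ℝ) : ℝ :=
  if r ≤ N.rB then N.G β t N.mL (c * r ^ (-N.αL)) else N.G β t N.mN (c * r ^ (-N.αN))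

/-- Locations seen through the main lobe of the reference receiver. -/
def mainLobe : Set ℂ :=
  {x | |Complex.arg (x * Complex.exp (-(N.φ₀ : ℂ) * Complex.I))| ≤ N.θra / 2}

theorem measurableSet_mainLobe : MeasurableSet N.mainLobe :=
  measurableSet_le (by fun_prop) measurable_const

theorem measurableSet_region : MeasurableSet N.region :=
  (measurableSet_le measurable_const measurable_norm).inter
    (measurableSet_le measurable_norm measurable_const)

theorem volume_region_ne_top : volume N.region ≠ ⊤ :=
  ne_top_of_le_ne_top (measure_closedBall_lt_top (x := (0 : ℂ)) (r := N.rOut)).ne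
    (measure_mono fun x hx => by simpa using hx.2)

theorem volume_region_ne_zero : volume N.region ≠ 0 := by
  have hopen : IsOpen {x : ℂ | N.rIn < ‖x‖ ∧ ‖x‖ < N.rOut} :=
    (isOpen_lt continuous_const continuous_norm).inter (isOpen_lt continuous_norm continuous_const)
  have hne : {x : ℂ | N.rIn < ‖x‖ ∧ ‖x‖ < N.rOut}.Nonempty := by
    obtain ⟨r, h1, h2⟩ := exists_between N.rIn_lt_rOut
    have h0 := N.rIn_pos.trans h1
    exact ⟨(r : ℂ), by simp [abs_of_pos h0, h1], by simp [abs_of_pos h0, h2]⟩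
  exact ((hopen.measure_pos volume hne).trans_le
    (measure_mono fun x (hx : N.rIn < ‖x‖ ∧ ‖x‖ < N.rOut) => And.intro hx.1.le hx.2.le)).ne'

instance isProbabilityMeasure_uniformLaw : IsProbabilityMeasure N.uniformLaw :=
  cond_isProbabilityMeasure_of_finite N.volume_region_ne_zero N.volume_region_ne_top

instance isMarkovKernel_fadingKernel : IsMarkovKernel N.fadingKernel := by
  have := isProbabilityMeasure_gammaMeasure N.mL_pos N.mL_pos
  have := isProbabilityMeasure_gammaMeasure N.mN_pos N.mN_pos
  unfold fadingKernel
  infer_instance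

/-- Inside and outside the main lobe of the receiver, `𝒢_t(Ω_i)` depends on the distance only. -/
theorem G_nakagami_powerGain (β : ℝ) (t : ℕ) (i : Fin K) (x : ℂ) :
    N.G β t (N.nakagami x) (N.powerGain i x)
      = N.mainLobe.indicator (fun x => N.radialG β t (N.a i) ‖x‖) x
        + N.mainLobeᶜ.indicator (fun x => N.radialG β t (N.b i) ‖x‖) x := by
  by_cases h1 : ‖x‖ ≤ N.rB <;>
  by_cases h2 : |Complex.arg (x * Complex.exp (-(N.φ₀ : ℂ) * Complex.I))| ≤ N.θra / 2 <;>
  simp only [nakagami, powerGain, pathLoss, losBall, mainLobe, radialG, indicator, mem_ofPred_eq,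
    mem_compl_iff, h1, h2, if_true, if_false, not_true, not_false_eq_true, add_zero, zero_add]

theorem measurable_G (β : ℝ) (t : ℕ) (m : ℝ) : Measurable (N.G β t m) := by
  unfold G Q
  fun_prop

theorem measurable_radialG (β : ℝ) (t : ℕ) (c : ℝ) : Measurable (N.radialG β t c) :=
  Measurable.ite measurableSet_Iic ((N.measurable_G β t _).comp (by fun_prop))
    ((N.measurable_G β t _).comp (by fun_prop))

theorem measurable_G_nakagami_powerGain (β : ℝ) (t : ℕ) (i : Fin K) :
    Measurable fun x => N.G β t (N.nakagami x) (N.powerGain i x) := by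
  simp_rw [G_nakagami_powerGain]
  exact (((N.measurable_radialG β t _).comp measurable_norm).indicator N.measurableSet_mainLobe).add
    (((N.measurable_radialG β t _).comp measurable_norm).indicator N.measurableSet_mainLobe.compl)

theorem a_pos (i : Fin K) : 0 < N.a i := mul_pos (div_pos (N.P_pos i) N.P₀_pos) N.Gr_pos

theorem b_pos (i : Fin K) : 0 < N.b i := mul_pos (div_pos (N.P_pos i) N.P₀_pos) N.gr_pos

theorem continuousOn_G_mul_rpow {β : ℝ} (hβ : 0 < β) (t : ℕ) {m c : ℝ} (α : ℝ) (hm : 0 < m)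
    (hc : 0 < c) : ContinuousOn (fun r => N.G β t m (c * r ^ (-α))) (Ioi 0) := by
  refine (N.continuousOn_G hβ t hm).comp (continuousOn_const.mul
    (ContinuousOn.rpow_const continuousOn_id fun r hr => Or.inl (ne_of_gt hr))) fun r hr => ?_
  exact mul_pos hc (Real.rpow_pos_of_pos hr _)

/-- On the annulus the distance stays away from `0`, so the power gain and `𝒢_t` are bounded. -/
theorem exists_bound_radialG {β : ℝ} (hβ : 0 < β) (t : ℕ) {c : ℝ} (hc : 0 < c) :
    ∃ C, ∀ r ∈ Icc N.rIn N.rOut, ‖N.radialG β t c r‖ ≤ C := by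
  have hsub : Icc N.rIn N.rOut ⊆ Ioi 0 := fun r hr => N.rIn_pos.trans_le hr.1
  obtain ⟨C₁, h₁⟩ := isCompact_Icc.exists_bound_of_continuousOn
    ((N.continuousOn_G_mul_rpow hβ t N.αL N.mL_pos hc).mono hsub)
  obtain ⟨C₂, h₂⟩ := isCompact_Icc.exists_bound_of_continuousOn
    ((N.continuousOn_G_mul_rpow hβ t N.αN N.mN_pos hc).mono hsub)
  refine ⟨max C₁ C₂, fun r hr => ?_⟩
  unfold radialG
  split_ifs
  · exact (h₁ r hr).trans (le_max_left _ _)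
  · exact (h₂ r hr).trans (le_max_right _ _)

theorem integrableOn_radialG_norm {β : ℝ} (hβ : 0 < β) (t : ℕ) {c : ℝ} (hc : 0 < c) :
    IntegrableOn (fun x : ℂ => N.radialG β t c ‖x‖) N.region := by
  obtain ⟨C, hC⟩ := N.exists_bound_radialG hβ t hc
  refine Measure.integrableOn_of_bounded (M := C) N.volume_region_ne_top
    ((N.measurable_radialG β t c).comp measurable_norm).aestronglyMeasurable ?_
  filter_upwards [ae_restrict_mem N.measurableSet_region] with x hx using hC _ hx

theorem integrable_G_uniformLaw {β : ℝ} (hβ : 0 < β) (t : ℕ) (i : Fin K) :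
    Integrable (fun x => N.G β t (N.nakagami x) (N.powerGain i x)) N.uniformLaw := by
  simp_rw [G_nakagami_powerGain]
  refine Integrable.smul_measure ?_ (ENNReal.inv_ne_top.mpr N.volume_region_ne_zero)
  exact ((N.integrableOn_radialG_norm hβ t (N.a_pos i)).indicator N.measurableSet_mainLobe).add
    ((N.integrableOn_radialG_norm hβ t (N.b_pos i)).indicator N.measurableSet_mainLobe.compl)

/-- The substitution `w = c r^{-α}` turns the radial integral over a range of distances into the
closed form `T` of the integral over the corresponding range of power gains. -/
theorem integral_mul_G_rpow {β : ℝ} (hβ : 0 < β) (t : ℕ) {m α c r₁ r₂ : ℝ} (hm : 0 < m)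
    (hα : 0 < α) (hc : 0 < c) (hr₁ : 0 < r₁) (hr : r₁ ≤ r₂) :
    2 * Real.pi / N.area * ∫ r in r₁..r₂, r * N.G β t m (c * r ^ (-α))
      = N.T β t m (c / r₂ ^ α) (c / r₁ ^ α) c α := by
  have hr₂ := hr₁.trans_le hr
  have hsub : uIcc r₁ r₂ ⊆ Ioi 0 := by
    rw [uIcc_of_le hr]; exact fun r h => hr₁.trans_le h.1
  have hint : IntervalIntegrable
      (fun r => 2 * Real.pi / N.area * (r * N.G β t m (c * r ^ (-α)))) volume r₁ r₂ :=
    (continuousOn_const.mul (continuousOn_id.mul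
      ((N.continuousOn_G_mul_rpow hβ t α hm hc).mono hsub))).intervalIntegrable
  have hder : ∀ r ∈ uIcc r₁ r₂, HasDerivAt (fun r => N.primitiveT β t m c α (c * r ^ (-α)))
      (2 * Real.pi / N.area * (r * N.G β t m (c * r ^ (-α)))) r := by
    intro r h
    have hr0 : 0 < r := hsub h
    have hw : 0 < c * r ^ (-α) := mul_pos hc (Real.rpow_pos_of_pos hr0 _)
    have h1 := (Real.hasDerivAt_rpow_const (x := r) (p := -α) (Or.inl hr0.ne')).const_mul c
    refine ((N.hasDerivAt_primitiveT hβ t c hm hα hw).comp r h1).congr_deriv ?_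
    have e1 : (c * r ^ (-α)) ^ (-((2 + α) / α)) = (c ^ (2 / α))⁻¹ * c⁻¹ * (r ^ 2 * r ^ α) := by
      rw [Real.mul_rpow hc.le (Real.rpow_nonneg hr0.le _), ← Real.rpow_mul hr0.le,
        show -((2 + α) / α) = -(2 / α) + -1 by field_simp; ring, Real.rpow_add hc,
        Real.rpow_neg hc.le, Real.rpow_neg_one,
        show -α * (-(2 / α) + -1) = (2 : ℕ) + α by field_simp; push_cast; ring,
        Real.rpow_add hr0, Real.rpow_natCast]
    have e2 : r ^ (-α - 1) = (r ^ α)⁻¹ * r⁻¹ := by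
      rw [Real.rpow_sub_one hr0.ne', Real.rpow_neg hr0.le, div_eq_mul_inv]
    rw [e1, e2]
    generalize N.G β t m (c * r ^ (-α)) = g
    have := Real.rpow_pos_of_pos hr0 α
    have := Real.rpow_pos_of_pos hc (2 / α)
    rcases eq_or_ne N.area 0 with hA | hA
    · simp [hA]
    · field_simp
  rw [← intervalIntegral.integral_const_mul,
    intervalIntegral.integral_eq_sub_of_hasDerivAt hder hint, T_eq_sub, Real.rpow_neg hr₁.le,
    Real.rpow_neg hr₂.le, ← div_eq_mul_inv, ← div_eq_mul_inv]

/-- The radial integral splits at the radius of the line-of-sight ball. -/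
theorem integral_mul_radialG {β : ℝ} (hβ : 0 < β) (t : ℕ) {c : ℝ} (hc : 0 < c) :
    2 * Real.pi / N.area * ∫ r in N.rIn..N.rOut, r * N.radialG β t c r = N.sectorTerm β t c := by
  have hB : 0 < N.rB := N.rIn_pos.trans_le N.rIn_le_rB
  have hII : ∀ {r₁ r₂ : ℝ} (m α : ℝ), 0 < m → 0 < r₁ → r₁ ≤ r₂ →
      IntervalIntegrable (fun r => r * N.G β t m (c * r ^ (-α))) volume r₁ r₂ := by
    intro r₁ r₂ m α hm hr₁ hr
    have hsub : uIcc r₁ r₂ ⊆ Ioi 0 := by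
      rw [uIcc_of_le hr]; exact fun r h => hr₁.trans_le h.1
    exact (continuousOn_id.mul
      ((N.continuousOn_G_mul_rpow hβ t α hm hc).mono hsub)).intervalIntegrable
  have hL : EqOn (fun r => r * N.G β t N.mL (c * r ^ (-N.αL))) (fun r => r * N.radialG β t c r)
      (uIoc N.rIn N.rB) := by
    intro r hr
    rw [uIoc_of_le N.rIn_le_rB] at hr
    simp [radialG, hr.2]
  have hN : EqOn (fun r => r * N.G β t N.mN (c * r ^ (-N.αN))) (fun r => r * N.radialG β t c r)
      (uIoc N.rB N.rOut) := by
    intro r hr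
    rw [uIoc_of_le N.rB_le_rOut] at hr
    simp [radialG, not_le.mpr hr.1]
  have hIL := hII N.mL N.αL N.mL_pos N.rIn_pos N.rIn_le_rB
  have hIN := hII N.mN N.αN N.mN_pos hB N.rB_le_rOut
  rw [← intervalIntegral.integral_add_adjacent_intervals (hIL.congr hL) (hIN.congr hN), mul_add,
    sectorTerm, ← N.integral_mul_G_rpow hβ t N.mL_pos N.αL_pos hc N.rIn_pos N.rIn_le_rB,
    ← N.integral_mul_G_rpow hβ t N.mN_pos N.αN_pos hc hB N.rB_le_rOut,
    intervalIntegral.integral_congr_ae (Filter.Eventually.of_forall hL),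
    intervalIntegral.integral_congr_ae (Filter.Eventually.of_forall hN)]

/-- The integral over the region of an angular times a radial function. -/
theorem setIntegral_region_arg_mul_norm (u F : ℝ → ℝ) :
    ∫ x in N.region, u (Complex.arg (x * Complex.exp (-(N.φ₀ : ℂ) * Complex.I))) * F ‖x‖
      = (∫ φ in Ioo (-Real.pi) Real.pi, u φ) * ∫ r in N.rIn..N.rOut, r * F r := by
  have h := integral_arg_rotate_mul_norm N.φ₀ u ((Icc N.rIn N.rOut).indicator F)
  have hsub : Icc N.rIn N.rOut ⊆ Ioi 0 := fun r hr => N.rIn_pos.trans_le hr.1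
  rw [← integral_indicator N.measurableSet_region]
  convert h using 1
  · congr 1
    ext x
    by_cases hx : x ∈ N.region
    · have hx' : ‖x‖ ∈ Icc N.rIn N.rOut := hx
      simp [hx, hx']
    · have hx' : ‖x‖ ∉ Icc N.rIn N.rOut := hx
      simp [hx, hx']
  · have e : (fun r => r * (Icc N.rIn N.rOut).indicator F r)
        = (Icc N.rIn N.rOut).indicator fun r => r * F r := by
      ext r
      by_cases hr : r ∈ Icc N.rIn N.rOut <;> simp [hr]
    rw [e, setIntegral_indicator measurableSet_Icc, inter_eq_right.mpr hsub,
      integral_Icc_eq_integral_Ioc, intervalIntegral.integral_of_le N.rIn_lt_rOut.le]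

/-- The mean of `𝒢_t(Ω_i)` over a uniform location. -/
theorem integral_G_uniformLaw {β : ℝ} (hβ : 0 < β) (t : ℕ) (i : Fin K) :
    ∫ x, N.G β t (N.nakagami x) (N.powerGain i x) ∂N.uniformLaw = N.meanG β i t := by
  have harea : (volume N.region)⁻¹.toReal = N.area⁻¹ := by
    rw [ENNReal.toReal_inv]; rfl
  rw [uniformLaw, ProbabilityTheory.cond, integral_smul_measure, harea, smul_eq_mul]
  simp_rw [G_nakagami_powerGain]
  rw [integral_add
    ((N.integrableOn_radialG_norm hβ t (N.a_pos i)).indicator N.measurableSet_mainLobe)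
    ((N.integrableOn_radialG_norm hβ t (N.b_pos i)).indicator N.measurableSet_mainLobe.compl)]
  set u : ℝ → ℝ := {φ | |φ| ≤ N.θra / 2}.indicator (fun _ => (1 : ℝ)) with hu
  have hm : MeasurableSet {φ : ℝ | |φ| ≤ N.θra / 2} :=
    measurableSet_le (by fun_prop) measurable_const
  have hua : (fun x : ℂ => N.mainLobe.indicator (fun x => N.radialG β t (N.a i) ‖x‖) x)
      = fun x => u (Complex.arg (x * Complex.exp (-(N.φ₀ : ℂ) * Complex.I)))
          * N.radialG β t (N.a i) ‖x‖ := by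
    ext x
    simp [hu, indicator, mainLobe]
  have hub : (fun x : ℂ => N.mainLobeᶜ.indicator (fun x => N.radialG β t (N.b i) ‖x‖) x)
      = fun x => (fun φ => 1 - u φ) (Complex.arg (x * Complex.exp (-(N.φ₀ : ℂ) * Complex.I)))
          * N.radialG β t (N.b i) ‖x‖ := by
    ext x
    by_cases h : |Complex.arg (x * Complex.exp (-(N.φ₀ : ℂ) * Complex.I))| ≤ N.θra / 2 <;>
      simp only [hu, indicator, mainLobe, mem_ofPred_eq, mem_compl_iff, h, if_true, if_false,
        not_true, not_false_eq_true] <;> ring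
  have hIu : ∫ φ in Ioo (-Real.pi) Real.pi, u φ = N.θra := integral_indicator_abs_le N.θra_mem
  have hIu' : ∫ φ in Ioo (-Real.pi) Real.pi, (1 - u φ) = 2 * Real.pi - N.θra := by
    rw [integral_sub (integrable_const _) ((integrable_const _).indicator hm), hIu,
      setIntegral_const, Real.volume_real_Ioo_of_le (by linarith [Real.pi_pos])]
    simp only [smul_eq_mul]
    ring
  rw [hua, hub, setIntegral_region_arg_mul_norm,
    N.setIntegral_region_arg_mul_norm (fun φ => 1 - u φ), hIu, hIu', meanG,
    ← N.integral_mul_radialG hβ t (N.a_pos i), ← N.integral_mul_radialG hβ t (N.b_pos i)]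
  have := Real.pi_pos
  field_simp

theorem IsLOSBallModel.hasLaw_X {N : Network K} {S : Type*} [MeasurableSpace S] {μ : Measure S}
    {X : Fin K → S → ℂ} {I h : Fin K → S → ℝ} {h₀ : S → ℝ} (hN : N.IsLOSBallModel μ X I h h₀)
    (i : Fin K) : HasLaw (X i) N.uniformLaw μ where
  aemeasurable := (hN.measurable_X i).aemeasurable
  map_eq := by
    have h1 := congrArg Measure.fst (hN.law_location_fading i).map_eq
    rwa [Measure.fst_compProd, Measure.fst, Measure.map_map measurable_fst
      ((hN.measurable_X i).prodMk (hN.measurable_h i))] at h1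

end Network
end MmWave

/-! ### Gamma distributions -/

namespace MmWave

/-- The derivative of the Erlang tail telescopes to its last term. -/
theorem hasDerivAt_exp_neg_mul_sum (n : ℕ) (u : ℝ) :
    HasDerivAt (fun u : ℝ => Real.exp (-u) * ∑ l ∈ Finset.range (n + 1), u ^ l / l.factorial)
      (-(Real.exp (-u) * (u ^ n / n.factorial))) u := by
  have hexp : HasDerivAt (fun u : ℝ => Real.exp (-u)) (-Real.exp (-u)) u := by
    simpa using (hasDerivAt_neg u).exp
  induction n with
  | zero => simpa using hexp
  | succ n ih =>
    have h := ih.add (hexp.mul ((hasDerivAt_pow (n + 1) u).div_const ((n + 1).factorial : ℝ)))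
    refine (h.congr_deriv ?_).congr_of_eventuallyEq (Filter.Eventually.of_forall fun v => ?_)
    · have h1 : ((n + 1).factorial : ℝ) = (n + 1) * n.factorial := by
        rw [Nat.factorial_succ]; push_cast; ring
      have h2 : (n.factorial : ℝ) ≠ 0 := Nat.cast_ne_zero.mpr n.factorial_ne_zero
      have h3 : (n : ℝ) + 1 ≠ 0 := by positivity
      simp only [Nat.add_sub_cancel, Nat.cast_add, Nat.cast_one]
      rw [h1]
      field_simp
      ring
    · simp only [Pi.add_apply, Pi.mul_apply]
      rw [Finset.sum_range_succ _ (n + 1)]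
      ring

theorem tendsto_exp_neg_mul_sum (n : ℕ) :
    Filter.Tendsto (fun u : ℝ => Real.exp (-u) * ∑ l ∈ Finset.range n, u ^ l / l.factorial)
      Filter.atTop (nhds 0) := by
  have h : Filter.Tendsto
      (fun u : ℝ => ∑ l ∈ Finset.range n, u ^ l * Real.exp (-u) / l.factorial)
      Filter.atTop (nhds (∑ l ∈ Finset.range n, 0 / (l.factorial : ℝ))) :=
    tendsto_finsetSum _ fun l _ => (Real.tendsto_pow_mul_exp_neg_atTop_nhds_zero l).div_const _
  simp only [zero_div, Finset.sum_const_zero] at h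
  refine h.congr fun u => ?_
  rw [Finset.mul_sum]
  exact Finset.sum_congr rfl fun l _ => by ring

/-- The survival function of a gamma distribution with integer shape (Erlang distribution). -/
theorem gammaMeasure_real_Ioi {n : ℕ} (hn : 0 < n) {r x : ℝ} (hr : 0 < r) (hx : 0 ≤ x) :
    (gammaMeasure n r).real (Ioi x)
      = Real.exp (-(r * x)) * ∑ l ∈ Finset.range n, (r * x) ^ l / l.factorial := by
  obtain ⟨k, rfl⟩ : ∃ k, n = k + 1 := ⟨n - 1, by omega⟩
  have hn' : (0 : ℝ) < ((k + 1 : ℕ) : ℝ) := Nat.cast_pos.mpr hn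
  have h1 : (gammaMeasure (k + 1 : ℕ) r).real (Ioi x)
      = ∫ y in Ioi x, gammaPDFReal (k + 1 : ℕ) r y := by
    rw [gammaMeasure, measureReal_def, withDensity_apply _ measurableSet_Ioi]
    refine (integral_eq_lintegral_of_nonneg_ae ?_ (by fun_prop)).symm
    exact Filter.Eventually.of_forall fun y => gammaPDFReal_nonneg hn' hr y
  set F : ℝ → ℝ := fun u =>
    Real.exp (-u) * ∑ l ∈ Finset.range (k + 1), u ^ l / l.factorial with hF
  have hder : ∀ y ∈ Ici x, HasDerivAt (fun y => -F (r * y)) (gammaPDFReal (k + 1 : ℕ) r y) y := by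
    intro y hy
    have hy0 : 0 ≤ y := hx.trans hy
    have h2 : HasDerivAt (fun y : ℝ => r * y) r y := by
      simpa using (hasDerivAt_id y).const_mul r
    refine ((hasDerivAt_exp_neg_mul_sum k (r * y)).comp y h2).neg.congr_deriv ?_
    have h3 : (((k + 1 : ℕ) : ℝ) - 1) = k := by push_cast; ring
    rw [gammaPDFReal, if_pos hy0, h3, Real.rpow_natCast, Real.rpow_natCast]
    push_cast
    rw [Real.Gamma_nat_eq_factorial]
    ring
  have htend : Filter.Tendsto (fun y => -F (r * y)) Filter.atTop (nhds 0) := by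
    simpa using ((tendsto_exp_neg_mul_sum (k + 1)).comp
      (Filter.tendsto_id.const_mul_atTop hr)).neg
  rw [h1, integral_Ioi_of_hasDerivAt_of_nonneg' hder
    (fun y _ => gammaPDFReal_nonneg hn' hr y) htend]
  simp [hF]

theorem ae_nonneg_gammaMeasure (a r : ℝ) : ∀ᵐ h ∂gammaMeasure a r, 0 ≤ h := by
  rw [ae_iff]
  have : {h : ℝ | ¬0 ≤ h} = Iio 0 := by ext; simp
  rw [this, gammaMeasure, withDensity_apply _ measurableSet_Iio]
  exact lintegral_gammaPDF_of_nonpos le_rfl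

/-- A moment of a gamma variable of unit mean, under exponential tilting: the integral is again a
gamma integral, with shape `m + t` and rate `m + b s`. -/
theorem integral_pow_mul_exp_gammaMeasure {m b s : ℝ} (hm : 0 < m) (hb : 0 ≤ b) (hs : 0 ≤ s)
    (t : ℕ) :
    ∫ h, (s * h) ^ t * Real.exp (-(b * (s * h))) ∂gammaMeasure m m
      = (s / m) ^ t * (Real.Gamma (m + t) / Real.Gamma m) * (1 + b * s / m) ^ (-(m + t)) := by
  have hG := Real.Gamma_pos_of_pos hm
  have hrate : 0 < m + b * s := by positivity
  rw [gammaMeasure, integral_withDensity_eq_integral_toReal_smul (f := gammaPDF m m)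
    (measurable_gammaPDFReal m m).ennreal_ofReal
    (Filter.Eventually.of_forall fun x => ENNReal.ofReal_lt_top)]
  have e1 : ∀ x : ℝ, (gammaPDF m m x).toReal • ((s * x) ^ t * Real.exp (-(b * (s * x))))
      = (Ici (0 : ℝ)).indicator (fun x => gammaPDFReal m m x *
          ((s * x) ^ t * Real.exp (-(b * (s * x))))) x := by
    intro x
    rw [gammaPDF, ENNReal.toReal_ofReal (gammaPDFReal_nonneg hm hm x), smul_eq_mul]
    by_cases hx : 0 ≤ x
    · simp [hx]
    · simp [hx, gammaPDFReal]
  simp_rw [e1]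
  rw [integral_indicator measurableSet_Ici, integral_Ici_eq_integral_Ioi]
  have e2 : ∫ x in Ioi (0 : ℝ), gammaPDFReal m m x * ((s * x) ^ t * Real.exp (-(b * (s * x))))
      = ∫ x in Ioi (0 : ℝ), m ^ m / Real.Gamma m * s ^ t
          * (x ^ (m + t - 1) * Real.exp (-((m + b * s) * x))) := by
    refine setIntegral_congr_fun measurableSet_Ioi fun x hx => ?_
    have hx : 0 < x := hx
    rw [gammaPDFReal, if_pos hx.le, show m + (t : ℝ) - 1 = m - 1 + t by ring,
      Real.rpow_add_natCast hx.ne', show -((m + b * s) * x) = -(m * x) + -(b * (s * x)) by ring,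
      Real.exp_add, mul_pow]
    ring
  rw [e2, integral_const_mul, Real.integral_rpow_mul_exp_neg_mul_Ioi (by positivity) hrate]
  have e3 : 1 + b * s / m = (m + b * s) / m := by field_simp
  rw [e3, Real.rpow_neg (by positivity), Real.div_rpow hrate.le hm.le,
    Real.div_rpow zero_le_one hrate.le, Real.one_rpow, Real.rpow_add_natCast hm.ne', div_pow]
  have := Real.rpow_pos_of_pos hm m
  have := Real.rpow_pos_of_pos hrate (m + t)
  field_simp

/-- The uniform bound behind the integrability of all tilted moments. -/
theorem pow_mul_exp_neg_le {b y : ℝ} (hb : 0 < b) (hy : 0 ≤ y) (t : ℕ) :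
    y ^ t * Real.exp (-(b * y)) ≤ t.factorial / b ^ t := by
  have h := Real.pow_div_factorial_le_exp (b * y) (by positivity) t
  have hf : (0 : ℝ) < t.factorial := Nat.cast_pos.mpr t.factorial_pos
  rw [Real.exp_neg, ← div_eq_mul_inv, div_le_div_iff₀ (Real.exp_pos _) (by positivity)]
  rw [div_le_iff₀ hf, mul_pow] at h
  linarith

end MmWave

/-! ### Tilted moments of the interference of one interferer -/

namespace MmWave
namespace Network

variable {K : ℕ} (N : Network K)

theorem nakagami_pos (x : ℂ) : 0 < N.nakagami x := by
  unfold nakagami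
  split_ifs
  exacts [N.mL_pos, N.mN_pos]

theorem fadingKernel_apply (x : ℂ) :
    N.fadingKernel x = gammaMeasure (N.nakagami x) (N.nakagami x) := by
  classical
  unfold fadingKernel nakagami
  rw [Kernel.piecewise_apply]
  split_ifs <;> rfl

theorem powerGain_nonneg (i : Fin K) (x : ℂ) : 0 ≤ N.powerGain i x := by
  unfold powerGain
  refine mul_nonneg ?_ (Real.rpow_nonneg (norm_nonneg _) _)
  split_ifs
  exacts [(N.a_pos i).le, (N.b_pos i).le]

theorem measurable_powerGain (i : Fin K) : Measurable (N.powerGain i) := by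
  unfold powerGain pathLoss
  refine (Measurable.ite N.measurableSet_mainLobe measurable_const measurable_const).mul ?_
  exact measurable_norm.pow
    (Measurable.ite N.measurableSet_losBall measurable_const measurable_const).neg

theorem pM_mem : N.pM ∈ Icc 0 1 := by
  have hπ := Real.pi_pos
  have h1 : 0 ≤ Real.sin (N.θte / 2) :=
    Real.sin_nonneg_of_nonneg_of_le_pi (by linarith [N.θte_mem.1]) (by linarith [N.θte_mem.2])
  have h2 : 0 ≤ N.θta / (2 * Real.pi) := div_nonneg N.θta_mem.1 (by positivity)
  have h3 : N.θta / (2 * Real.pi) ≤ 1 := (div_le_one (by positivity)).mpr N.θta_mem.2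
  exact ⟨mul_nonneg h2 h1, mul_le_one₀ h3 h1 (Real.sin_le_one _)⟩

instance isFiniteMeasure_gainLaw : IsFiniteMeasure N.gainLaw := by
  unfold gainLaw
  have (r : ℝ) (x : ℝ) : IsFiniteMeasure (ENNReal.ofReal r • Measure.dirac x) :=
    ⟨by simp⟩
  infer_instance

theorem ae_nonneg_gainLaw : ∀ᵐ x ∂N.gainLaw, 0 ≤ x := by
  have hm : MeasurableSet {x : ℝ | 0 ≤ x} := measurableSet_Ici
  have h (r : ℝ) {x : ℝ} (hx : 0 ≤ x) : ∀ᵐ y ∂(ENNReal.ofReal r • Measure.dirac x), 0 ≤ y :=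
    Measure.ae_smul_measure ((ae_dirac_iff hm).mpr hx) _
  unfold gainLaw
  rw [ae_add_measure_iff, ae_add_measure_iff]
  exact ⟨⟨h _ le_rfl, h _ N.Gt_pos.le⟩, h _ N.gt_pos.le⟩

theorem integral_gainLaw (g : ℝ → ℝ) :
    ∫ x, g x ∂N.gainLaw
      = (1 - N.pt) * g 0 + N.pt * N.pM * g N.Gt + N.pt * (1 - N.pM) * g N.gt := by
  have hp := N.pt_mem
  have hM := N.pM_mem
  have hi (r : ℝ) (x : ℝ) : Integrable g (ENNReal.ofReal r • Measure.dirac x) :=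
    (integrable_dirac (by simp)).smul_measure ENNReal.ofReal_ne_top
  unfold gainLaw
  rw [integral_add_measure ((hi _ _).add_measure (hi _ _)) (hi _ _),
    integral_add_measure (hi _ _) (hi _ _), integral_smul_measure, integral_smul_measure,
    integral_smul_measure, integral_dirac, integral_dirac, integral_dirac,
    ENNReal.toReal_ofReal (by linarith [hp.2]), ENNReal.toReal_ofReal (mul_nonneg hp.1 hM.1),
    ENNReal.toReal_ofReal (mul_nonneg hp.1 (by linarith [hM.2]))]
  simp only [smul_eq_mul]

theorem ae_nonneg_fading : ∀ᵐ p ∂(N.uniformLaw ⊗ₘ N.fadingKernel), 0 ≤ p.2 := by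
  refine Measure.ae_compProd_of_ae_ae (measurableSet_le measurable_const measurable_snd) ?_
  refine Filter.Eventually.of_forall fun x => ?_
  rw [fadingKernel_apply]
  exact ae_nonneg_gammaMeasure _ _

/-- The exponentially tilted power `y ^ t e^{-β₀ y}` of the interference `y = I h Ω` of one
interferer, as a function of its location, relative power and fading gain. -/
noncomputable def tiltedPower (β : ℝ) (i : Fin K) (t : ℕ) (p : ℂ × ℝ × ℝ) : ℝ :=
  (p.2.1 * p.2.2 * N.powerGain i p.1) ^ t
    * Real.exp (-(N.beta₀ β * (p.2.1 * p.2.2 * N.powerGain i p.1)))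

theorem measurable_tiltedPower (β : ℝ) (i : Fin K) (t : ℕ) :
    Measurable (N.tiltedPower β i t) := by
  have := N.measurable_powerGain i
  unfold tiltedPower
  fun_prop

theorem norm_tiltedPower_le {β : ℝ} (hβ : 0 < β) (i : Fin K) (t : ℕ) {p : ℂ × ℝ × ℝ}
    (h1 : 0 ≤ p.2.1) (h2 : 0 ≤ p.2.2) :
    ‖N.tiltedPower β i t p‖ ≤ t.factorial / N.beta₀ β ^ t := by
  have h : 0 ≤ p.2.1 * p.2.2 * N.powerGain i p.1 :=
    mul_nonneg (mul_nonneg h1 h2) (N.powerGain_nonneg i _)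
  rw [tiltedPower, Real.norm_of_nonneg (mul_nonneg (pow_nonneg h _) (Real.exp_pos _).le)]
  exact pow_mul_exp_neg_le (N.beta₀_pos hβ) h t

/-- Integrating out the fading at a fixed location and relative power. -/
theorem integral_tiltedPower_fadingKernel {β : ℝ} (hβ : 0 < β) (i : Fin K) (t : ℕ) (x : ℂ)
    {g : ℝ} (hg : 0 ≤ g) :
    ∫ h, N.tiltedPower β i t (x, g, h) ∂N.fadingKernel x
      = (N.powerGain i x / N.nakagami x) ^ t
        * (Real.Gamma (N.nakagami x + t) / Real.Gamma (N.nakagami x))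
        * N.Q β t (N.nakagami x) (N.powerGain i x) g := by
  have h := integral_pow_mul_exp_gammaMeasure (N.nakagami_pos x) (N.beta₀_pos hβ).le
    (mul_nonneg hg (N.powerGain_nonneg i x)) t
  rw [fadingKernel_apply]
  have e : ∀ y : ℝ, N.tiltedPower β i t (x, g, y)
      = (g * N.powerGain i x * y) ^ t
        * Real.exp (-(N.beta₀ β * (g * N.powerGain i x * y))) := by
    intro y
    rw [tiltedPower, mul_right_comm]
  simp_rw [e]
  rw [h, Q, div_pow, div_pow, mul_pow, ← mul_assoc (N.beta₀ β)]
  ring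

/-- Averaging over the three values of the relative power gives `t! 𝒢_t`. The value `0` contributes
only for `t = 0`, which accounts for the term with `δ[t]`. -/
theorem sum_gain_eq_factorial_mul_G (β : ℝ) (t : ℕ) {m : ℝ} (hm : 0 < m) (w : ℝ) :
    (1 - N.pt) * ((w / m) ^ t * (Real.Gamma (m + t) / Real.Gamma m) * N.Q β t m w 0)
      + N.pt * N.pM * ((w / m) ^ t * (Real.Gamma (m + t) / Real.Gamma m) * N.Q β t m w N.Gt)
      + N.pt * (1 - N.pM) * ((w / m) ^ t * (Real.Gamma (m + t) / Real.Gamma m) * N.Q β t m w N.gt)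
    = t.factorial * N.G β t m w := by
  have hG := (Real.Gamma_pos_of_pos hm).ne'
  have hf : (t.factorial : ℝ) ≠ 0 := Nat.cast_ne_zero.mpr t.factorial_ne_zero
  have h0 : (w / m) ^ t * (Real.Gamma (m + t) / Real.Gamma m) * N.Q β t m w 0
      = t.factorial * (if t = 0 then 1 else 0) := by
    rcases Nat.eq_zero_or_pos t with rfl | ht
    · simp [Q, hG]
    · simp [Q, ht.ne']
  have hsplit : Real.Gamma (m + t) / (t.factorial * Real.Gamma m) * t.factorial
      = Real.Gamma (m + t) / Real.Gamma m := by field_simp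
  rw [h0, G, ← hsplit]
  ring

namespace IsLOSBallModel

variable {N} {S : Type*} [MeasurableSpace S] {μ : Measure S}
  {X : Fin K → S → ℂ} {I h : Fin K → S → ℝ} {h₀ : S → ℝ}

theorem ae_nonneg_I (hN : N.IsLOSBallModel μ X I h h₀) (i : Fin K) : ∀ᵐ s ∂μ, 0 ≤ I i s := by
  have := N.ae_nonneg_gainLaw
  rw [← (hN.law_gain i).map_eq] at this
  exact ae_of_ae_map (hN.measurable_I i).aemeasurable this

theorem ae_nonneg_h (hN : N.IsLOSBallModel μ X I h h₀) (i : Fin K) : ∀ᵐ s ∂μ, 0 ≤ h i s := by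
  have := N.ae_nonneg_fading
  rw [← (hN.law_location_fading i).map_eq] at this
  exact ae_of_ae_map ((hN.measurable_X i).prodMk (hN.measurable_h i)).aemeasurable this

theorem measurable_triple (hN : N.IsLOSBallModel μ X I h h₀) (i : Fin K) :
    Measurable fun s => (X i s, I i s, h i s) :=
  (hN.measurable_X i).prodMk ((hN.measurable_I i).prodMk (hN.measurable_h i))

theorem integral_G (hN : N.IsLOSBallModel μ X I h h₀) (β : ℝ) (i : Fin K) (t : ℕ) :
    ∫ s, N.G β t (N.nakagami (X i s)) (N.powerGain i (X i s)) ∂μ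
      = ∫ x, N.G β t (N.nakagami x) (N.powerGain i x) ∂N.uniformLaw :=
  (hN.hasLaw_X i).integral_comp (N.measurable_G_nakagami_powerGain β t i).aestronglyMeasurable

theorem integrable_G (hN : N.IsLOSBallModel μ X I h h₀) {β : ℝ} (hβ : 0 < β) (i : Fin K) (t : ℕ) :
    Integrable (fun s => N.G β t (N.nakagami (X i s)) (N.powerGain i (X i s))) μ := by
  have := N.integrable_G_uniformLaw hβ t i
  rw [← (hN.hasLaw_X i).map_eq] at this
  exact this.comp_measurable (hN.measurable_X i)

/-- The tilted moment of the interference of one interferer is `t! 𝔼[𝒢_t(Ω_i)]`. -/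
theorem integral_tiltedPower [IsProbabilityMeasure μ] (hN : N.IsLOSBallModel μ X I h h₀)
    {β : ℝ} (hβ : 0 < β) (i : Fin K) (t : ℕ) :
    ∫ s, N.tiltedPower β i t (X i s, I i s, h i s) ∂μ
      = t.factorial * ∫ s, N.G β t (N.nakagami (X i s)) (N.powerGain i (X i s)) ∂μ := by
  have hlaw := (hN.indep_gain i).hasLaw_prod (hN.law_gain i) (hN.law_location_fading i)
  have hmeas : Measurable fun q : ℝ × ℂ × ℝ => N.tiltedPower β i t (q.2.1, q.1, q.2.2) :=
    (N.measurable_tiltedPower β i t).comp (by fun_prop)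
  have hI : Integrable (fun q : ℝ × ℂ × ℝ => N.tiltedPower β i t (q.2.1, q.1, q.2.2))
      (N.gainLaw.prod (N.uniformLaw ⊗ₘ N.fadingKernel)) := by
    refine Integrable.of_bound hmeas.aestronglyMeasurable (t.factorial / N.beta₀ β ^ t) ?_
    filter_upwards [Measure.quasiMeasurePreserving_fst.ae N.ae_nonneg_gainLaw,
      Measure.quasiMeasurePreserving_snd.ae N.ae_nonneg_fading] with q h1 h2
    exact N.norm_tiltedPower_le hβ i t h1 h2
  -- the conditional mean given the location, at relative power `g`
  set k : ℝ → ℂ → ℝ := fun g x => (N.powerGain i x / N.nakagami x) ^ t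
        * (Real.Gamma (N.nakagami x + t) / Real.Gamma (N.nakagami x))
        * N.Q β t (N.nakagami x) (N.powerGain i x) g with hk
  have hfix : ∀ g, 0 ≤ g →
      Integrable (k g) N.uniformLaw ∧
      ∫ p, N.tiltedPower β i t (p.1, g, p.2) ∂(N.uniformLaw ⊗ₘ N.fadingKernel)
        = ∫ x, k g x ∂N.uniformLaw := by
    intro g hg
    have hmg : Measurable fun p : ℂ × ℝ => N.tiltedPower β i t (p.1, g, p.2) :=
      (N.measurable_tiltedPower β i t).comp (by fun_prop)
    have hig : Integrable (fun p : ℂ × ℝ => N.tiltedPower β i t (p.1, g, p.2))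
        (N.uniformLaw ⊗ₘ N.fadingKernel) := by
      refine Integrable.of_bound hmg.aestronglyMeasurable (t.factorial / N.beta₀ β ^ t) ?_
      filter_upwards [N.ae_nonneg_fading] with p h2
      exact N.norm_tiltedPower_le hβ i t hg h2
    have hkg : (fun x => ∫ h, N.tiltedPower β i t (x, g, h) ∂N.fadingKernel x) = k g :=
      funext fun x => N.integral_tiltedPower_fadingKernel hβ i t x hg
    refine ⟨?_, ?_⟩
    · rw [← hkg]
      have := Integrable.integral_compProd hig
      simpa using this
    · rw [Measure.integral_compProd hig, ← hkg]
  obtain ⟨i0, e0⟩ := hfix 0 le_rfl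
  obtain ⟨i1, e1⟩ := hfix N.Gt N.Gt_pos.le
  obtain ⟨i2, e2⟩ := hfix N.gt N.gt_pos.le
  have hstep : ∫ s, N.tiltedPower β i t (X i s, I i s, h i s) ∂μ
      = ∫ q, N.tiltedPower β i t (q.2.1, q.1, q.2.2)
          ∂(N.gainLaw.prod (N.uniformLaw ⊗ₘ N.fadingKernel)) :=
    hlaw.integral_comp (f := fun q : ℝ × ℂ × ℝ => N.tiltedPower β i t (q.2.1, q.1, q.2.2))
      hmeas.aestronglyMeasurable
  have i01 : Integrable (fun x => (1 - N.pt) * k 0 x + N.pt * N.pM * k N.Gt x) N.uniformLaw :=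
    (i0.const_mul _).add (i1.const_mul _)
  rw [hstep, integral_prod _ hI, integral_gainLaw]
  rw [e0, e1, e2, hN.integral_G, ← integral_const_mul, ← integral_const_mul, ← integral_const_mul,
    ← integral_const_mul, ← integral_add (i0.const_mul _) (i1.const_mul _),
    ← integral_add i01 (i2.const_mul _)]
  exact integral_congr_ae (Filter.Eventually.of_forall fun x =>
    N.sum_gain_eq_factorial_mul_G β t (N.nakagami_pos x) _)

end IsLOSBallModel
end Network
end MmWave

/-! ### The coverage probability -/

namespace MmWave
namespace Network

variable {K : ℕ} (N : Network K)

/-- The total interference, as a function of the locations, relative powers and fading gains. -/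
noncomputable def interference (p : Fin K → ℂ × ℝ × ℝ) : ℝ :=
  ∑ i, (p i).2.1 * (p i).2.2 * N.powerGain i (p i).1

theorem measurable_interference : Measurable N.interference := by
  have := N.measurable_powerGain
  unfold interference
  fun_prop

theorem interference_nonneg {p : Fin K → ℂ × ℝ × ℝ} (h1 : ∀ i, 0 ≤ (p i).2.1)
    (h2 : ∀ i, 0 ≤ (p i).2.2) : 0 ≤ N.interference p :=
  Finset.sum_nonneg fun i _ => mul_nonneg (mul_nonneg (h1 i) (h2 i)) (N.powerGain_nonneg i _)

/-- The multinomial expansion of a tilted power of the interference. -/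
theorem interference_pow_mul_exp (β : ℝ) (t : ℕ) (p : Fin K → ℂ × ℝ × ℝ) :
    N.interference p ^ t * Real.exp (-(N.beta₀ β * N.interference p))
      = ∑ τ ∈ Finset.piAntidiag (Finset.univ : Finset (Fin K)) t,
          (Nat.multinomial Finset.univ τ : ℝ) * ∏ i, N.tiltedPower β i (τ i) (p i) := by
  have hexp : Real.exp (-(N.beta₀ β * N.interference p))
      = ∏ i, Real.exp (-(N.beta₀ β * ((p i).2.1 * (p i).2.2 * N.powerGain i (p i).1))) := by
    rw [← Real.exp_sum, interference, Finset.mul_sum, Finset.sum_neg_distrib]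
  rw [hexp, interference, Finset.sum_pow_eq_sum_piAntidiag, Finset.sum_mul]
  refine Finset.sum_congr rfl fun τ _ => ?_
  rw [mul_assoc, ← Finset.prod_mul_distrib]
  rfl

/-- Expansion of the Erlang tail at noise plus interference `y` in tilted powers of `y`. -/
theorem exp_mul_sum_add_eq (β y : ℝ) :
    Real.exp (-(N.beta₀ β * (N.noise + y)))
        * ∑ l ∈ Finset.range N.m₀, (N.beta₀ β * (N.noise + y)) ^ l / l.factorial
      = Real.exp (-(N.beta₀ β * N.noise)) *
        ∑ l ∈ Finset.range N.m₀, (N.beta₀ β * N.noise) ^ l / l.factorial *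
          ∑ t ∈ Finset.range (l + 1), (l.choose t : ℝ) * (1 / N.noise ^ t)
            * (y ^ t * Real.exp (-(N.beta₀ β * y))) := by
  have hσ := N.noise_pos.ne'
  rw [mul_add, neg_add, Real.exp_add, mul_assoc]
  congr 1
  rw [Finset.mul_sum]
  refine Finset.sum_congr rfl fun l _ => ?_
  rw [← mul_add, mul_pow, add_comm N.noise y, add_pow, mul_pow, Finset.mul_sum, Finset.sum_div,
    Finset.mul_sum, Finset.mul_sum]
  refine Finset.sum_congr rfl fun t ht => ?_
  have ht : t ≤ l := Nat.lt_succ_iff.mp (Finset.mem_range.mp ht)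
  rw [← Nat.sub_add_cancel ht, Nat.add_sub_cancel, pow_add N.noise]
  field_simp

/-- For nonnegative interference coverage says that the reference fading exceeds a threshold. -/
theorem lt_sinr_iff (β h₀ : ℝ) (x : Fin K → ℂ) (I h : Fin K → ℝ)
    (hy : 0 ≤ N.interference fun i => (x i, I i, h i)) :
    β < N.sinr h₀ x I h ↔
      β / (N.Gt * N.powerGain₀) * (N.noise + N.interference fun i => (x i, I i, h i)) < h₀ := by
  have hσ := N.noise_pos
  have hG := N.Gt_pos
  have hΩ := N.powerGain₀_pos
  have hden : 0 < N.noise + N.interference fun i => (x i, I i, h i) := by linarith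
  have e : N.sinr h₀ x I h
      = N.Gt * h₀ * N.powerGain₀ / (N.noise + N.interference fun i => (x i, I i, h i)) := rfl
  rw [e, lt_div_iff₀ hden, div_mul_eq_mul_div, div_lt_iff₀ (mul_pos hG hΩ),
    show h₀ * (N.Gt * N.powerGain₀) = N.Gt * h₀ * N.powerGain₀ by ring]

namespace IsLOSBallModel

variable {N} {S : Type*} [MeasurableSpace S] {μ : Measure S}
  {X : Fin K → S → ℂ} {I h : Fin K → S → ℝ} {h₀ : S → ℝ}

theorem measurable_triples (hN : N.IsLOSBallModel μ X I h h₀) :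
    Measurable fun s i => (X i s, I i s, h i s) :=
  measurable_pi_lambda _ hN.measurable_triple

theorem ae_interference_nonneg (hN : N.IsLOSBallModel μ X I h h₀) :
    ∀ᵐ s ∂μ, 0 ≤ N.interference fun i => (X i s, I i s, h i s) := by
  filter_upwards [ae_all_iff.mpr hN.ae_nonneg_I, ae_all_iff.mpr hN.ae_nonneg_h] with s h1 h2
  exact N.interference_nonneg h1 h2

theorem integrable_prod_tiltedPower [IsProbabilityMeasure μ] (hN : N.IsLOSBallModel μ X I h h₀)
    {β : ℝ} (hβ : 0 < β) (τ : Fin K → ℕ) :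
    Integrable (fun s => ∏ i, N.tiltedPower β i (τ i) (X i s, I i s, h i s)) μ := by
  refine Integrable.of_bound (Finset.measurable_prod _ fun i _ =>
    (N.measurable_tiltedPower β i (τ i)).comp (hN.measurable_triple i)).aestronglyMeasurable
    (∏ i, ((τ i).factorial / N.beta₀ β ^ (τ i) : ℝ)) ?_
  filter_upwards [ae_all_iff.mpr hN.ae_nonneg_I, ae_all_iff.mpr hN.ae_nonneg_h] with s h1 h2
  rw [norm_prod]
  exact Finset.prod_le_prod (fun i _ => norm_nonneg _)
    fun i _ => N.norm_tiltedPower_le hβ i (τ i) (h1 i) (h2 i)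

theorem integrable_interference_pow_mul_exp [IsProbabilityMeasure μ]
    (hN : N.IsLOSBallModel μ X I h h₀) {β : ℝ} (hβ : 0 < β) (t : ℕ) :
    Integrable (fun s => (N.interference fun i => (X i s, I i s, h i s)) ^ t
      * Real.exp (-(N.beta₀ β * N.interference fun i => (X i s, I i s, h i s)))) μ := by
  simp_rw [interference_pow_mul_exp]
  exact integrable_finsetSum _ fun τ _ => (hN.integrable_prod_tiltedPower hβ τ).const_mul _

/-- Tilted moments of the interference: independence factorizes each multinomial term. -/
theorem integral_interference_pow_mul_exp [IsProbabilityMeasure μ]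
    (hN : N.IsLOSBallModel μ X I h h₀) {β : ℝ} (hβ : 0 < β) (t : ℕ) :
    ∫ s, (N.interference fun i => (X i s, I i s, h i s)) ^ t
      * Real.exp (-(N.beta₀ β * N.interference fun i => (X i s, I i s, h i s))) ∂μ
      = t.factorial * ∑ τ ∈ Finset.piAntidiag (Finset.univ : Finset (Fin K)) t,
          ∏ i, ∫ s, N.G β (τ i) (N.nakagami (X i s)) (N.powerGain i (X i s)) ∂μ := by
  simp_rw [interference_pow_mul_exp]
  rw [integral_finsetSum _ fun τ _ => (hN.integrable_prod_tiltedPower hβ τ).const_mul _,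
    Finset.mul_sum]
  refine Finset.sum_congr rfl fun τ hτ => ?_
  rw [integral_const_mul, hN.indep_interferers.integral_fun_prod_comp
    (f := fun i => N.tiltedPower β i (τ i)) (fun i => (hN.measurable_triple i).aemeasurable)
    (fun i => (N.measurable_tiltedPower β i (τ i)).aestronglyMeasurable)]
  simp_rw [hN.integral_tiltedPower hβ]
  rw [Finset.prod_mul_distrib, ← mul_assoc]
  congr 1
  have hsum : ∑ i, τ i = t := (Finset.mem_piAntidiag.mp hτ).1
  have := Nat.multinomial_spec Finset.univ τ
  rw [hsum] at this
  rw [← this]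
  push_cast
  ring

/-- Coverage probability, conditionally on the interference: the tail of the reference fading. -/
theorem measureReal_coverage_eq_integral [IsProbabilityMeasure μ]
    (hN : N.IsLOSBallModel μ X I h h₀) {β : ℝ} (hβ : 0 < β) :
    μ.real {s | β < N.sinr (h₀ s) (fun i => X i s) (fun i => I i s) (fun i => h i s)}
      = ∫ s, Real.exp (-(N.beta₀ β * (N.noise + N.interference fun i => (X i s, I i s, h i s))))
        * ∑ l ∈ Finset.range N.m₀,
          (N.beta₀ β * (N.noise + N.interference fun i => (X i s, I i s, h i s))) ^ l
            / l.factorial ∂μ := by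
  have hm₀ : (0 : ℝ) < N.m₀ := Nat.cast_pos.mpr N.m₀_pos
  have := isProbabilityMeasure_gammaMeasure hm₀ hm₀
  set Y : S → ℝ := fun s => N.interference fun i => (X i s, I i s, h i s) with hY
  have hYm : Measurable Y := N.measurable_interference.comp hN.measurable_triples
  set κ : ℝ := β / (N.Gt * N.powerGain₀) with hκ
  have hκ0 : 0 < κ := div_pos hβ (mul_pos N.Gt_pos N.powerGain₀_pos)
  have hind : IndepFun h₀ Y μ := hN.indep_h₀.comp measurable_id N.measurable_interference
  have hlaw : HasLaw Y (μ.map Y) μ := ⟨hYm.aemeasurable, rfl⟩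
  have : IsProbabilityMeasure (μ.map Y) := Measure.isProbabilityMeasure_map hYm.aemeasurable
  have hprod := hind.hasLaw_prod hN.law_h₀ hlaw
  have hset : MeasurableSet {q : ℝ × ℝ | κ * (N.noise + q.2) < q.1} :=
    measurableSet_lt (by fun_prop) (by fun_prop)
  have h1 : μ.real {s | β < N.sinr (h₀ s) (fun i => X i s) (fun i => I i s) (fun i => h i s)}
      = μ.real {s | κ * (N.noise + Y s) < h₀ s} := by
    refine measureReal_congr ?_
    filter_upwards [hN.ae_interference_nonneg] with s hs
    exact propext (N.lt_sinr_iff β (h₀ s) _ _ _ hs)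
  have h2 : μ.real {s | κ * (N.noise + Y s) < h₀ s}
      = ((gammaMeasure N.m₀ N.m₀).prod (μ.map Y)).real
          {q : ℝ × ℝ | κ * (N.noise + q.2) < q.1} :=
    hprod.measureReal_eq (p := fun q : ℝ × ℝ => κ * (N.noise + q.2) < q.1) hset
  have h3 : ((gammaMeasure N.m₀ N.m₀).prod (μ.map Y)).real
        {q : ℝ × ℝ | κ * (N.noise + q.2) < q.1}
      = ∫ y, (gammaMeasure N.m₀ N.m₀).real (Ioi (κ * (N.noise + y))) ∂μ.map Y := by
    rw [measureReal_def, Measure.prod_apply_symm hset, ← integral_toReal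
      (measurable_measure_prodMk_right hset).aemeasurable
      (Filter.Eventually.of_forall fun y => measure_lt_top _ _)]
    rfl
  have hmeas : Measurable fun y => (gammaMeasure N.m₀ N.m₀).real (Ioi (κ * (N.noise + y))) :=
    (measurable_measure_prodMk_right hset).ennreal_toReal
  rw [h1, h2, h3, integral_map hYm.aemeasurable hmeas.aestronglyMeasurable]
  refine integral_congr_ae ?_
  filter_upwards [hN.ae_interference_nonneg] with s hs
  have hx : 0 ≤ κ * (N.noise + Y s) := mul_nonneg hκ0.le (add_nonneg N.noise_pos.le hs)
  have e : (N.m₀ : ℝ) * (κ * (N.noise + Y s)) = N.beta₀ β * (N.noise + Y s) := by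
    rw [hκ, beta₀]; ring
  rw [gammaMeasure_real_Ioi N.m₀_pos hm₀ hx, e]

theorem measureReal_coverage_eq_productForm [IsProbabilityMeasure μ]
    (hN : N.IsLOSBallModel μ X I h h₀) {β : ℝ} (hβ : 0 < β) :
    μ.real {s | β < N.sinr (h₀ s) (fun i => X i s) (fun i => I i s) (fun i => h i s)}
      = N.productForm β
          (fun i t => ∫ s, N.G β t (N.nakagami (X i s)) (N.powerGain i (X i s)) ∂μ) := by
  have hint := hN.integrable_interference_pow_mul_exp hβ
  rw [hN.measureReal_coverage_eq_integral hβ, productForm]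
  simp_rw [exp_mul_sum_add_eq]
  rw [integral_const_mul, integral_finsetSum _ fun l _ =>
    (integrable_finsetSum _ fun t _ => (hint t).const_mul _).const_mul _]
  congr 1
  refine Finset.sum_congr rfl fun l _ => ?_
  rw [integral_const_mul, integral_finsetSum _ fun t _ => (hint t).const_mul _]
  congr 1
  refine Finset.sum_congr rfl fun t _ => ?_
  rw [integral_const_mul, hN.integral_interference_pow_mul_exp hβ]
  ring

theorem measurableSet_coverage (hN : N.IsLOSBallModel μ X I h h₀) (β : ℝ) :
    MeasurableSet
      {s | β < N.sinr (h₀ s) (fun i => X i s) (fun i => I i s) (fun i => h i s)} :=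
  measurableSet_lt measurable_const (((hN.measurable_h₀.const_mul _).mul_const _).div
    ((N.measurable_interference.comp hN.measurable_triples).const_add _))

end IsLOSBallModel
end Network
end MmWave

theorem mainTheorem3 {K : ℕ} (N : MmWave.Network K)
    {S : Type*} [MeasurableSpace S] (μ : Measure S) [IsProbabilityMeasure μ]
    (X : Fin K → S → ℂ) (I h : Fin K → S → ℝ) (h₀ : S → ℝ)
    (hmodel : N.IsLOSBallModel μ X I h h₀) (β : ℝ) (hβ : 0 < β) :
    -- the spatial average of the coverage probability given the locations, in product form
    (μ.real {s | β < N.sinr (h₀ s) (fun i => X i s) (fun i => I i s) (fun i => h i s)}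
      = ∫ s, (μ⟦{s | β < N.sinr (h₀ s) (fun i => X i s) (fun i => I i s) (fun i => h i s)} |
          MeasurableSpace.comap (fun s i => X i s) MeasurableSpace.pi⟧) s ∂μ) ∧
    (μ.real {s | β < N.sinr (h₀ s) (fun i => X i s) (fun i => I i s) (fun i => h i s)}
      = N.productForm β
          (fun i t => ∫ s, N.G β t (N.nakagami (X i s)) (N.powerGain i (X i s)) ∂μ)) ∧
    -- the closed form of each expectation
    (∀ (i : Fin K) (t : ℕ),
      Integrable (fun s => N.G β t (N.nakagami (X i s)) (N.powerGain i (X i s))) μ ∧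
      ∫ s, N.G β t (N.nakagami (X i s)) (N.powerGain i (X i s)) ∂μ = N.meanG β i t) ∧
    -- the integral formula from which the closed form is assembled
    (∀ (t : ℕ) (m α c w₁ w₂ : ℝ), 0 < m → 0 < α → 0 < c → 0 < w₁ → w₁ ≤ w₂ →
      IntegrableOn (fun w => N.D w w₁ w₂ c α * N.G β t m w) (Ioi 0) ∧
      ∫ w in Ioi 0, N.D w w₁ w₂ c α * N.G β t m w = N.T β t m w₁ w₂ c α) := by
  refine ⟨?_, hmodel.measureReal_coverage_eq_productForm hβ, fun i t => ?_,
    fun t m α c w₁ w₂ hm hα _ hw₁ hw =>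
      N.integrableOn_and_integral_D_mul_G hβ t c hm hα hw₁ hw⟩
  · have hle : MeasurableSpace.comap (fun s i => X i s) MeasurableSpace.pi ≤ ‹MeasurableSpace S› :=
      (measurable_pi_lambda _ hmodel.measurable_X).comap_le
    rw [integral_condExp hle, integral_indicator_const _ (hmodel.measurableSet_coverage β)]
    simp
  · exact ⟨hmodel.integrable_G hβ i t, by rw [hmodel.integral_G, N.integral_G_uniformLaw hβ]⟩
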